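/- **Setting.** Let $n\ge 1$, let $f:\mathbb R^n\times\mathbb R^m\to\mathbb R^n$ be twice continuously differentiable with $f(0,0)=0$, let $\mathcal U\subset\mathbb R^m$ be compact with $0\in\mathcal U$, and let $L>0$ satisfy $\|f(x,u)-f(y,u)\|\le L\|x-y\|$ for all $x,y\in\mathbb R^n$, $u\in\mathcal U$. The disturbed system is $\dot x=f(x,u)+\omega$ with $\omega$ measurable and $\omega(t)\in\mathcal W$, where $\mathcal W\subset\mathbb R^n$ is compact and nonempty; put $\rho=\sup_{w\in\mathcal W}\|w\|$. Let $A=\partial f/\partial x(0,0)$, $B=\partial f/\partial u(0,0)$, and let $Q,R$ be symmetric positive definite. Write $\|x\|_S=\sqrt{x^\top Sx}$, and $\overline\lambda,\underline\lambda$ for the largest and smallest eigenvalue. *Terminal design.* $(K,\kappa,P,\epsilon)$ is a terminal design if $\kappa>0$, $\kappa<-\operatorname{Re}z$ for every eigenvalue $z$ of $A+BK$, $P$ is positive definite with $(A+BK+\kappa I)^\top P+P(A+BK+\kappa I)=-Q^*$, where $Q^*=Q+K^\top RK$, $\epsilon>0$, and for all $x\in\Omega(\epsilon)=\{x:\|x\|_P\le\epsilon\}$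 one has $Kx\in\mathcal U$ and $2x^\top Pf(x,Kx)\le-\|x\|_{Q^*}^2$ (that is, $V=\|x\|_P^2$ satisfies $\dot V\le-\|x\|_{Q^*}^2$ along $\dot x=f(x,Kx)$). *MPC problem.* With horizon $T$, contraction rate $M$ and $\alpha\in(0,1)$, the MPC problem at time $t_k$ from state $x(t_k)$ is to minimize $$\int_{t_k}^{t_k+T}\big(\|\hat x(s)\|_Q^2+\|\hat u(s)\|_R^2\big)\,ds+\|\hat x(t_k+T)\|_P^2$$ over piecewise continuous, right-continuous controls $\hat u$ on $[t_k,t_k+T]$ with values in $\mathcal U$, subject to $\dot{\hat x}=f(\hat x,\hat u)$, $\hat x(t_k)=x(t_k)$ and the robustness constraint $$\|\hat x(s)\|_P\le\frac{(t_k+T-s)M+s-t_k}{T}\,\alpha\epsilon,\qquad s\in[t_k,t_k+T].$$ A control satisfying all these constraints is called feasible. *Triggering.* With $\beta\in(0,1)$ let $$\delta=\rho\,\overline\lambda(\sqrt P)\Big[e^{L\beta T}\Big(\frac{\beta T}{L}-\frac1{L^2}\Big)+\frac1{L^2}\Big],\qquad G=\frac{L^2\beta T\,e^{L(1-\beta)T}}{L\beta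 T-1}.$$ From $t_k$ on, a control $\hat u_k$ with predicted state $\hat x_k$ is applied, giving the real state $x_k$ on $[t_k,t_k+T]$ (the solution of the disturbed system with $x_k(t_k)=x(t_k)$). The next instant is $t_{k+1}=\min\{t_k+H_k,\,t_k+T\}$ with $H_k=\inf\{h>0:\int_{t_k}^{t_k+h}\|x_k(s)-\hat x_k(s)\|_P\,ds=\delta\}$ ($\inf\emptyset=\infty$), and $x(t_{k+1})=x_k(t_{k+1})$. **Theorem 2 (Feasibility).** Assume that some $K_0$ makes $A+BK_0$ Hurwitz. (a) If $0$ is an interior point of $\mathcal U$, then a terminal design $(K,\kappa,P,\epsilon)$ exists. (b) Let $(K,\kappa,P,\epsilon)$ be any terminal design, let $\alpha,\beta\in(0,1)$, and let $$T\ge\max\Big\{-2\frac{\overline\lambda(P)}{\underline\lambda(Q^*)\beta}\ln\alpha,\ \frac1{L\beta}\Big\},\quad L\beta T\ne1,\qquad M\ge\max\Big\{G\,\frac{\delta}{\alpha\epsilon}+1,\ 1-\frac1\beta+\frac1{\alpha\beta}\Big\}.$$ Then the condition $$G\,\delta\le(1-\alpha)\epsilon\qquad(*)$$ is equivalent to the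 explicit disturbance bound $$\rho\le\frac{(1-\alpha)\epsilon}{G\,\overline\lambda(\sqrt P)\big[e^{L\beta T}\big(\frac{\beta T}{L}-\frac1{L^2}\big)+\frac1{L^2}\big]}.$$ If $(*)$ holds and the MPC problem is feasible at $t_0$ from $x(t_0)$, then, for every disturbance $\omega$ as above, the MPC problem is iteratively (recursively) feasible: for every $N\ge0$, if at each of $t_0,\dots,t_{N-1}$ a feasible control (in particular, an optimal one) has been applied, then the MPC problem at $t_N$ from the state $x(t_N)$ has a feasible control. -/

import Mathlib

open Set Filter Topology MeasureTheory
open scoped Matrix MatrixOrder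

noncomputable section

/-- `ℝ^n` with the Euclidean norm. -/
abbrev Vec (n : ℕ) : Type := EuclideanSpace ℝ (Fin n)

/-- The `S`-weighted norm `‖x‖_S = √(xᵀ S x)`. -/
def wnorm {n : ℕ} (S : Matrix (Fin n) (Fin n) ℝ) (x : Vec n) : ℝ :=
  Real.sqrt (x.ofLp ⬝ᵥ (S *ᵥ x.ofLp))

/-- Largest eigenvalue of a symmetric real matrix. -/
def lamMax {n : ℕ} (S : Matrix (Fin n) (Fin n) ℝ) : ℝ := sSup (spectrum ℝ S)

/-- Smallest eigenvalue of a symmetric real matrix. -/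
def lamMin {n : ℕ} (S : Matrix (Fin n) (Fin n) ℝ) : ℝ := sInf (spectrum ℝ S)

/-- The matrix-vector product `K x`, as a map between Euclidean spaces. -/
def feedback {n m : ℕ} (K : Matrix (Fin m) (Fin n) ℝ) (x : Vec n) : Vec m :=
  WithLp.toLp 2 (K *ᵥ x.ofLp)

/-- The state Jacobian `A = ∂f/∂x` at `(0,0)`. -/
def jacA {n m : ℕ} (f : Vec n → Vec m → Vec n) : Matrix (Fin n) (Fin n) ℝ :=
  Matrix.of fun i j => (fderiv ℝ (fun x => f x 0) 0 (EuclideanSpace.single j 1)) i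

/-- The input Jacobian `B = ∂f/∂u` at `(0,0)`. -/
def jacB {n m : ℕ} (f : Vec n → Vec m → Vec n) : Matrix (Fin n) (Fin m) ℝ :=
  Matrix.of fun i j => (fderiv ℝ (fun u => f 0 u) 0 (EuclideanSpace.single j 1)) i

/-- A real matrix is stable (Hurwitz): all its complex eigenvalues have negative real part. -/
def IsHurwitz {n : ℕ} (S : Matrix (Fin n) (Fin n) ℝ) : Prop :=
  ∀ z ∈ spectrum ℂ (S.map (algebraMap ℝ ℂ)), z.re < 0

/-- `Q* = Q + Kᵀ R K`. -/
def qStar {n m : ℕ} (Q : Matrix (Fin n) (Fin n) ℝ) (R : Matrix (Fin m) (Fin m) ℝ)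
    (K : Matrix (Fin m) (Fin n) ℝ) : Matrix (Fin n) (Fin n) ℝ :=
  Q + Kᵀ * R * K

/-- The terminal design: a gain `K`, a number `κ > 0` below `-Re z` for all eigenvalues `z` of
`A + BK`, the positive definite solution `P` of the Lyapunov equation
`(A + BK + κI)ᵀ P + P (A + BK + κI) = -Q*`, and a level `ε > 0` such that, on the set
`Ω(ε) = {x : ‖x‖_P ≤ ε}`, the law `u = Kx` is admissible and the derivative `2 xᵀ P f(x, Kx)`
of `V(x) = ‖x‖_P²` along `x' = f(x, Kx)` is at most `-‖x‖_{Q*}²`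
(hence `Ω(ε)` is invariant under `x' = f(x, Kx)`). -/
structure IsTerminalDesign {n m : ℕ} (f : Vec n → Vec m → Vec n) (U : Set (Vec m))
    (Q : Matrix (Fin n) (Fin n) ℝ) (R : Matrix (Fin m) (Fin m) ℝ)
    (K : Matrix (Fin m) (Fin n) ℝ) (κ : ℝ) (P : Matrix (Fin n) (Fin n) ℝ) (ε : ℝ) : Prop where
  kappa_pos : 0 < κ
  kappa_lt : ∀ z ∈ spectrum ℂ ((jacA f + jacB f * K).map (algebraMap ℝ ℂ)), κ < -z.re
  posDef : P.PosDef
  lyapunov : (jacA f + jacB f * K + κ • (1 : Matrix (Fin n) (Fin n) ℝ))ᵀ * P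
      + P * (jacA f + jacB f * K + κ • (1 : Matrix (Fin n) (Fin n) ℝ)) = -qStar Q R K
  eps_pos : 0 < ε
  admissible : ∀ x : Vec n, wnorm P x ≤ ε → feedback K x ∈ U
  decrease : ∀ x : Vec n, wnorm P x ≤ ε →
    2 * (x.ofLp ⬝ᵥ (P *ᵥ (f x (feedback K x)).ofLp)) ≤ -(wnorm (qStar Q R K) x) ^ 2

/-- Piecewise continuous and right-continuous functions on `[a,b]`: right-continuous on `[a,b)`,
with left limits on `(a,b]`, and with finitely many discontinuities. -/
def PiecewiseRightContinuous {m : ℕ} (u : ℝ → Vec m) (a b : ℝ) : Prop :=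
  (∀ s ∈ Ico a b, ContinuousWithinAt u (Ici s) s) ∧
  (∀ s ∈ Ioc a b, ∃ l : Vec m, Tendsto u (𝓝[<] s) (𝓝 l)) ∧
  {s ∈ Ioo a b | ¬ ContinuousAt u s}.Finite

/-- `x` solves `x'(s) = F(s, x(s))` on `[a,b]` in the sense of Carathéodory
(the right-hand side may be discontinuous in time). -/
def IsSolution {n : ℕ} (F : ℝ → Vec n → Vec n) (a b : ℝ) (x : ℝ → Vec n) : Prop :=
  ContinuousOn x (Icc a b) ∧
  IntervalIntegrable (fun s => F s (x s)) volume a b ∧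
  ∀ s ∈ Icc a b, x s = x a + ∫ τ in a..s, F τ (x τ)

/-- The data of the MPC optimization problem: dynamics, input set, weights, horizon, contraction
rate, scaling ratio and level of the terminal set. -/
structure MPCProblem (n m : ℕ) where
  f : Vec n → Vec m → Vec n
  U : Set (Vec m)
  Q : Matrix (Fin n) (Fin n) ℝ
  R : Matrix (Fin m) (Fin m) ℝ
  P : Matrix (Fin n) (Fin n) ℝ
  T : ℝ
  M : ℝ
  α : ℝ
  ε : ℝ

/-- The control `u` with predicted state `y` is feasible for the problem posed at time `t` from the
state `ξ`: `u` takes values in `U`, `y` is the nominal trajectory from `ξ`, and `y` satisfies the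
linearly contracting robustness constraint on `[t, t+T]`. -/
structure MPCProblem.IsFeasible {n m : ℕ} (p : MPCProblem n m) (t : ℝ) (ξ : Vec n)
    (u : ℝ → Vec m) (y : ℝ → Vec n) : Prop where
  control : PiecewiseRightContinuous u t (t + p.T)
  input : ∀ s ∈ Icc t (t + p.T), u s ∈ p.U
  init : y t = ξ
  nominal : IsSolution (fun s z => p.f z (u s)) t (t + p.T) y
  robust : ∀ s ∈ Icc t (t + p.T),
    wnorm p.P (y s) ≤ ((t + p.T - s) * p.M + s - t) / p.T * (p.α * p.ε)

/-- The cost functional `J`. -/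
def MPCProblem.cost {n m : ℕ} (p : MPCProblem n m) (t : ℝ) (u : ℝ → Vec m) (y : ℝ → Vec n) : ℝ :=
  (∫ s in t..(t + p.T), ((wnorm p.Q (y s)) ^ 2 + (wnorm p.R (u s)) ^ 2))
    + (wnorm p.P (y (t + p.T))) ^ 2

/-- `u`, `y` solve the MPC optimization problem: they are feasible and minimize the cost. -/
def MPCProblem.IsOptimal {n m : ℕ} (p : MPCProblem n m) (t : ℝ) (ξ : Vec n)
    (u : ℝ → Vec m) (y : ℝ → Vec n) : Prop :=
  p.IsFeasible t ξ u y ∧ ∀ u' y', p.IsFeasible t ξ u' y' → p.cost t u y ≤ p.cost t u' y'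

/-- The next triggering instant `min {t + H, t + T}`, where `H` is the infimum of the `h > 0` with
`∫_t^{t+h} ‖x(s) - y(s)‖_P ds = δ` (and `H = ∞` if there is none): the infimum of these `h` in
`(0, T]` and of `T` itself. -/
def nextInstant {n : ℕ} (P : Matrix (Fin n) (Fin n) ℝ) (δ T t : ℝ) (x y : ℝ → Vec n) : ℝ :=
  t + sInf (insert T
    {h : ℝ | 0 < h ∧ h ≤ T ∧ ∫ s in t..(t + h), wnorm P (x s - y s) = δ})

/-- The first `N` steps of the integral-type event-triggered closed loop with disturbance `w`,
started at time `t₀` from the state `x₀`: `t k` are the triggering instants, `ξ k` the states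
sampled there, `u k` the control computed at `t k`, `y k` its predicted state, and `x k` the real
state on `[t k, t k + T]` under `u k` and the disturbance. -/
structure IsEventTriggeredRun {n m : ℕ} (p : MPCProblem n m) (δ : ℝ) (w : ℝ → Vec n)
    (t₀ : ℝ) (x₀ : Vec n) (N : ℕ) (t : ℕ → ℝ) (ξ : ℕ → Vec n)
    (u : ℕ → ℝ → Vec m) (y x : ℕ → ℝ → Vec n) : Prop where
  time_zero : t 0 = t₀
  state_zero : ξ 0 = x₀
  real_init : ∀ k < N, x k (t k) = ξ k
  real_sol : ∀ k < N, IsSolution (fun s z => p.f z (u k s) + w s) (t k) (t k + p.T) (x k)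
  time_succ : ∀ k < N, t (k + 1) = nextInstant p.P δ p.T (t k) (x k) (y k)
  state_succ : ∀ k < N, ξ (k + 1) = x k (t (k + 1))

/-- Iterative feasibility: however long the closed loop has been run, with any feasible controls
applied at the previous triggering instants, the MPC problem is feasible at the current one. -/
def IterativelyFeasible {n m : ℕ} (p : MPCProblem n m) (δ : ℝ) (w : ℝ → Vec n)
    (t₀ : ℝ) (x₀ : Vec n) : Prop :=
  ∀ (N : ℕ) (t : ℕ → ℝ) (ξ : ℕ → Vec n) (u : ℕ → ℝ → Vec m) (y x : ℕ → ℝ → Vec n),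
    IsEventTriggeredRun p δ w t₀ x₀ N t ξ u y x →
    (∀ k < N, p.IsFeasible (t k) (ξ k) (u k) (y k)) →
    ∃ v z, p.IsFeasible (t N) (ξ N) v z

/-- Iterative feasibility for the closed loop in which optimal controls are applied. -/
def IterativelyFeasibleOptimal {n m : ℕ} (p : MPCProblem n m) (δ : ℝ) (w : ℝ → Vec n)
    (t₀ : ℝ) (x₀ : Vec n) : Prop :=
  ∀ (N : ℕ) (t : ℕ → ℝ) (ξ : ℕ → Vec n) (u : ℕ → ℝ → Vec m) (y x : ℕ → ℝ → Vec n),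
    IsEventTriggeredRun p δ w t₀ x₀ N t ξ u y x →
    (∀ k < N, p.IsOptimal (t k) (ξ k) (u k) (y k)) →
    ∃ v z, p.IsFeasible (t N) (ξ N) v z

/-- The disturbance bound `ρ = sup_{w ∈ W} ‖w‖`. -/
def disturbanceBound {n : ℕ} (W : Set (Vec n)) : ℝ := sSup ((fun w => ‖w‖) '' W)

/-- The factor `λ̄(√P) [e^{LβT} (βT/L - 1/L²) + 1/L²]`. -/
def triggerFactor {n : ℕ} (P : Matrix (Fin n) (Fin n) ℝ) (L β T : ℝ) : ℝ :=
  lamMax (CFC.sqrt P)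
    * (Real.exp (L * β * T) * (β * T / L - 1 / L ^ 2) + 1 / L ^ 2)

/-- The triggering level `δ = ρ λ̄(√P) [e^{LβT} (βT/L - 1/L²) + 1/L²]`. -/
def triggerLevel {n : ℕ} (P : Matrix (Fin n) (Fin n) ℝ) (L β T ρ : ℝ) : ℝ :=
  ρ * triggerFactor P L β T

/-- The factor `L² β T e^{L(1-β)T} / (LβT - 1)`. -/
def errorGain (L β T : ℝ) : ℝ :=
  L ^ 2 * β * T * Real.exp (L * (1 - β) * T) / (L * β * T - 1)

end

/-! ### Weighted norms and extreme eigenvalues -/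

/-! Existence of a terminal design is Lyapunov's method with a margin. A Hurwitz `A + BK` stays
Hurwitz after adding a small `κI`, so the shifted Lyapunov equation has a positive definite solution
(`exists_posDef_lyapunov`, reduced by a Cayley transform to a convergent series). The shift
contributes an extra `-2κ‖x‖_P²` to the derivative of `‖x‖_P²`, which absorbs the linearization
remainder near the origin.

Recursive feasibility rests on one candidate: keep the old control until its horizon ends, then use
`u = Kx` (`exists_isFeasible_shift`). The level `δ` is the integral over `[0, βT]` of an upper bound
for the prediction error, so for `ρ > 0` no trigger occurs before `βT` has elapsed
(`integral_wnorm_sub_lt`). By Grönwall the candidate then differs from the old prediction by at most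
`λ̄(√P)(ρ/L)e^{LT} ≤ Gδ ≤ (1-α)ε` in `‖·‖_P` up to the old horizon. Shifting the window by `h ≥ βT`
raises the linear constraint by `(h/T)(M-1)αε`, which the bound on `M` makes at least `(1-α)ε`. At
the old horizon the prediction is at most `αε`, so the candidate is in `Ω(ε)`. From there it decays
exponentially (`IsTerminalDesign.exists_trajectory`), and by convexity the exponential stays below
the linear constraint, since `T` is long enough for a decay by the factor `α` within `βT`. -/

lemma dotProduct_self_eq_norm_sq {n : ℕ} (x : Vec n) : x.ofLp ⬝ᵥ x.ofLp = ‖x‖ ^ 2 := by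
  rw [EuclideanSpace.real_norm_sq_eq]
  simp [dotProduct, pow_two]

lemma dotProduct_mulVec_mono {n : ℕ} {S S' : Matrix (Fin n) (Fin n) ℝ} (h : S ≤ S')
    (x : Fin n → ℝ) : x ⬝ᵥ (S *ᵥ x) ≤ x ⬝ᵥ (S' *ᵥ x) := by
  have := (Matrix.le_iff.1 h).dotProduct_mulVec_nonneg x
  rw [star_trivial, Matrix.sub_mulVec, dotProduct_sub] at this
  linarith

lemma dotProduct_algebraMap_mulVec {n : ℕ} (r : ℝ) (x : Vec n) :
    x.ofLp ⬝ᵥ (algebraMap ℝ (Matrix (Fin n) (Fin n) ℝ) r *ᵥ x.ofLp) = r * ‖x‖ ^ 2 := by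
  rw [Algebra.algebraMap_eq_smul_one, Matrix.smul_mulVec, Matrix.one_mulVec, dotProduct_smul,
    dotProduct_self_eq_norm_sq, smul_eq_mul]

lemma le_lamMax {n : ℕ} {S : Matrix (Fin n) (Fin n) ℝ} {r : ℝ} (h : r ∈ spectrum ℝ S) :
    r ≤ lamMax S :=
  le_csSup Matrix.finite_real_spectrum.bddAbove h

lemma lamMin_le {n : ℕ} {S : Matrix (Fin n) (Fin n) ℝ} {r : ℝ} (h : r ∈ spectrum ℝ S) :
    lamMin S ≤ r :=
  csInf_le Matrix.finite_real_spectrum.bddBelow h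

lemma dotProduct_mulVec_le_lamMax {n : ℕ} {S : Matrix (Fin n) (Fin n) ℝ} (hS : S.IsHermitian)
    (x : Vec n) : x.ofLp ⬝ᵥ (S *ᵥ x.ofLp) ≤ lamMax S * ‖x‖ ^ 2 := by
  rw [← dotProduct_algebraMap_mulVec]
  exact dotProduct_mulVec_mono (le_algebraMap_of_spectrum_le (fun _ h => le_lamMax h) hS) _

lemma lamMin_le_dotProduct_mulVec {n : ℕ} {S : Matrix (Fin n) (Fin n) ℝ} (hS : S.IsHermitian)
    (x : Vec n) : lamMin S * ‖x‖ ^ 2 ≤ x.ofLp ⬝ᵥ (S *ᵥ x.ofLp) := by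
  rw [← dotProduct_algebraMap_mulVec]
  exact dotProduct_mulVec_mono (algebraMap_le_of_le_spectrum (fun _ h => lamMin_le h) hS) _

lemma spectrum_real_nonempty {n : ℕ} (hn : 0 < n) {S : Matrix (Fin n) (Fin n) ℝ}
    (hS : S.IsHermitian) : (spectrum ℝ S).Nonempty := by
  have : Nonempty (Fin n) := ⟨⟨0, hn⟩⟩
  rw [hS.spectrum_real_eq_range_eigenvalues]
  exact range_nonempty _

lemma pos_of_mem_spectrum_of_posDef {n : ℕ} {S : Matrix (Fin n) (Fin n) ℝ} (hS : S.PosDef)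
    {r : ℝ} (h : r ∈ spectrum ℝ S) : 0 < r := by
  rw [hS.1.spectrum_real_eq_range_eigenvalues] at h
  obtain ⟨i, rfl⟩ := h
  exact hS.eigenvalues_pos i

lemma lamMax_pos {n : ℕ} (hn : 0 < n) {S : Matrix (Fin n) (Fin n) ℝ} (hS : S.PosDef) :
    0 < lamMax S := by
  obtain ⟨r, hr⟩ := spectrum_real_nonempty hn hS.1
  exact (pos_of_mem_spectrum_of_posDef hS hr).trans_le (le_lamMax hr)

lemma lamMin_pos {n : ℕ} (hn : 0 < n) {S : Matrix (Fin n) (Fin n) ℝ} (hS : S.PosDef) :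
    0 < lamMin S :=
  pos_of_mem_spectrum_of_posDef hS
    ((spectrum_real_nonempty hn hS.1).csInf_mem Matrix.finite_real_spectrum)

lemma sqrt_mul_sqrt_of_posDef {n : ℕ} {P : Matrix (Fin n) (Fin n) ℝ} (hP : P.PosDef) :
    CFC.sqrt P * CFC.sqrt P = P :=
  CFC.sqrt_mul_sqrt_self P hP.posSemidef.nonneg

lemma posSemidef_sqrt {n : ℕ} (P : Matrix (Fin n) (Fin n) ℝ) : (CFC.sqrt P).PosSemidef :=
  Matrix.nonneg_iff_posSemidef.1 (CFC.sqrt_nonneg P)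

lemma posDef_sqrt {n : ℕ} {P : Matrix (Fin n) (Fin n) ℝ} (hP : P.PosDef) :
    (CFC.sqrt P).PosDef := by
  rw [(posSemidef_sqrt P).posDef_iff_isUnit]
  have h := hP.isUnit
  rw [← sqrt_mul_sqrt_of_posDef hP] at h
  exact isUnit_of_mul_isUnit_left h

lemma norm_sq_toLp_mulVec {n : ℕ} {S : Matrix (Fin n) (Fin n) ℝ} (hS : S.IsHermitian)
    (x : Vec n) : ‖(WithLp.toLp 2 (S *ᵥ x.ofLp) : Vec n)‖ ^ 2 = x.ofLp ⬝ᵥ ((S * S) *ᵥ x.ofLp) := by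
  rw [← dotProduct_self_eq_norm_sq, Matrix.dotProduct_mulVec, ← Matrix.mulVec_transpose,
    ← Matrix.conjTranspose_eq_transpose_of_trivial, hS.eq, dotProduct_comm,
    Matrix.mulVec_mulVec]

lemma wnorm_eq_norm {n : ℕ} {P : Matrix (Fin n) (Fin n) ℝ} (hP : P.PosDef) (x : Vec n) :
    wnorm P x = ‖(WithLp.toLp 2 (CFC.sqrt P *ᵥ x.ofLp) : Vec n)‖ := by
  rw [wnorm, ← Real.sqrt_sq (norm_nonneg (WithLp.toLp 2 (CFC.sqrt P *ᵥ x.ofLp) : Vec n)),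
    norm_sq_toLp_mulVec (posSemidef_sqrt P).1, sqrt_mul_sqrt_of_posDef hP]

lemma wnorm_sq {n : ℕ} {P : Matrix (Fin n) (Fin n) ℝ} (hP : P.PosSemidef) (x : Vec n) :
    wnorm P x ^ 2 = x.ofLp ⬝ᵥ (P *ᵥ x.ofLp) :=
  Real.sq_sqrt (hP.dotProduct_mulVec_nonneg x.ofLp)

lemma wnorm_nonneg {n : ℕ} (P : Matrix (Fin n) (Fin n) ℝ) (x : Vec n) : 0 ≤ wnorm P x :=
  Real.sqrt_nonneg _

lemma wnorm_zero {n : ℕ} (P : Matrix (Fin n) (Fin n) ℝ) : wnorm P 0 = 0 := by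
  simp [wnorm]

lemma wnorm_add_le {n : ℕ} {P : Matrix (Fin n) (Fin n) ℝ} (hP : P.PosDef) (x y : Vec n) :
    wnorm P (x + y) ≤ wnorm P x + wnorm P y := by
  simp only [wnorm_eq_norm hP, WithLp.ofLp_add, Matrix.mulVec_add, WithLp.toLp_add]
  exact norm_add_le _ _

lemma continuous_wnorm {n : ℕ} (P : Matrix (Fin n) (Fin n) ℝ) : Continuous (wnorm P) := by
  unfold wnorm
  fun_prop

lemma wnorm_le {n : ℕ} {P : Matrix (Fin n) (Fin n) ℝ} (hP : P.PosDef) (x : Vec n) :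
    wnorm P x ≤ lamMax (CFC.sqrt P) * ‖x‖ := by
  rcases Nat.eq_zero_or_pos n with rfl | hn
  · rw [Subsingleton.elim x 0, wnorm_zero, norm_zero, mul_zero]
  have hS := posDef_sqrt hP
  have hl := lamMax_pos hn hS
  refine Real.sqrt_le_iff.2 ⟨by positivity, ?_⟩
  rw [mul_pow, ← dotProduct_algebraMap_mulVec]
  refine dotProduct_mulVec_mono ?_ _
  -- On the positive spectrum of `√P`, squaring is bounded by the square of the largest eigenvalue;
  -- functional calculus carries this over to `P = (√P)²`.
  calc P = cfc (fun r : ℝ => r ^ 2) (CFC.sqrt P) := by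
        refine Eq.trans ?_ (cfc_pow_id (R := ℝ) (CFC.sqrt P) 2 hS.1).symm
        rw [pow_two, sqrt_mul_sqrt_of_posDef hP]
    _ ≤ _ := cfc_le_algebraMap _ _ _ (fun r hr => by
        have := pos_of_mem_spectrum_of_posDef hS hr
        have := le_lamMax hr
        gcongr) (by fun_prop) hS.1

lemma wnorm_sq_le {n : ℕ} {P : Matrix (Fin n) (Fin n) ℝ} (hP : P.PosDef) (x : Vec n) :
    wnorm P x ^ 2 ≤ lamMax P * ‖x‖ ^ 2 := by
  rw [wnorm_sq hP.posSemidef]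
  exact dotProduct_mulVec_le_lamMax hP.1 x

lemma lamMin_mul_le_wnorm_sq {n : ℕ} {P : Matrix (Fin n) (Fin n) ℝ} (hP : P.PosDef) (x : Vec n) :
    lamMin P * ‖x‖ ^ 2 ≤ wnorm P x ^ 2 := by
  rw [wnorm_sq hP.posSemidef]
  exact lamMin_le_dotProduct_mulVec hP.1 x

lemma wnorm_pos {n : ℕ} {P : Matrix (Fin n) (Fin n) ℝ} (hP : P.PosDef) {x : Vec n} (hx : x ≠ 0) :
    0 < wnorm P x :=
  Real.sqrt_pos.2 (hP.dotProduct_mulVec_pos (x := x.ofLp) (by simpa using hx))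

lemma posDef_qStar {n m : ℕ} {Q : Matrix (Fin n) (Fin n) ℝ} {R : Matrix (Fin m) (Fin m) ℝ}
    (hQ : Q.PosDef) (hR : R.PosDef) (K : Matrix (Fin m) (Fin n) ℝ) : (qStar Q R K).PosDef := by
  refine hQ.add_posSemidef ?_
  rw [← Matrix.conjTranspose_eq_transpose_of_trivial]
  exact hR.posSemidef.conjTranspose_mul_mul_same K

/-! ### The Lyapunov equation -/

section Lyapunov

attribute [local instance] Matrix.linftyOpNormedRing Matrix.linftyOpNormedAlgebra
  Matrix.linftyOpNormedAddCommGroup Matrix.linftyOpNormedSpace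

/-- The row-sum norm does not change under complexification, so Gelfand's formula over `ℂ` controls
real powers. -/
lemma norm_map_complex {n : ℕ} (C : Matrix (Fin n) (Fin n) ℝ) :
    ‖C.map (algebraMap ℝ ℂ)‖ = ‖C‖ := by
  simp [Matrix.linfty_opNorm_def]

/-- Powers of a matrix with spectral radius less than one decay geometrically in norm. -/
lemma exists_norm_pow_le {n : ℕ} (C : Matrix (Fin n) (Fin n) ℝ)
    (hC : ∀ z ∈ spectrum ℂ (C.map (algebraMap ℝ ℂ)), ‖z‖ < 1) :
    ∃ q : ℝ, 0 ≤ q ∧ q < 1 ∧ ∀ᶠ k in atTop, ‖C ^ k‖ ≤ q ^ k := by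
  rcases Nat.eq_zero_or_pos n with rfl | hn
  · exact ⟨0, le_rfl, one_pos, .of_forall fun k => by
      rw [Subsingleton.elim (C ^ k) 0, norm_zero]; positivity⟩
  have : Nonempty (Fin n) := ⟨⟨0, hn⟩⟩
  set D := C.map (algebraMap ℝ ℂ) with hD
  have h1 : spectralRadius ℂ D < (1 : NNReal) :=
    spectrum.spectralRadius_lt_of_forall_lt D fun z hz => by simpa [← NNReal.coe_lt_coe] using hC z hz
  -- Any `q` strictly between the spectral radius and 1 works: by Gelfand's formula the roots `‖D ^
  -- k‖ ^ (1/k)` are eventually below it.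
  obtain ⟨q, hq1, hq2⟩ := ENNReal.lt_iff_exists_nnreal_btwn.1 h1
  refine ⟨q, q.2, by exact_mod_cast hq2, ?_⟩
  filter_upwards [(spectrum.pow_nnnorm_pow_one_div_tendsto_nhds_spectralRadius D).eventually_lt_const
    hq1, eventually_gt_atTop 0] with k hk hk0
  have hDk : ‖C ^ k‖ = ‖D ^ k‖ := by
    rw [← norm_map_complex, Matrix.map_pow]
  rw [hDk]
  have h2 : (‖D ^ k‖₊ : ENNReal) ≤ (q : ENNReal) ^ k := by
    have hk' : (k : ℝ) ≠ 0 := by positivity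
    have := ENNReal.rpow_le_rpow hk.le (Nat.cast_nonneg k : (0 : ℝ) ≤ k)
    rwa [← ENNReal.rpow_mul, one_div_mul_cancel hk', ENNReal.rpow_one, ENNReal.rpow_natCast] at this
  exact_mod_cast h2

/-- The Stein equation `P - Cᵀ P C = S` has a positive definite solution if `C` is Schur stable. -/
lemma exists_posDef_stein {n : ℕ} (C S : Matrix (Fin n) (Fin n) ℝ)
    (hC : ∀ z ∈ spectrum ℂ (C.map (algebraMap ℝ ℂ)), ‖z‖ < 1) (hS : S.PosDef) :
    ∃ P : Matrix (Fin n) (Fin n) ℝ, P.PosDef ∧ P - Cᵀ * P * C = S := by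
  obtain ⟨q, hq0, hq1, hq⟩ := exists_norm_pow_le C hC
  obtain ⟨q', hq0', hq1', hq'⟩ := exists_norm_pow_le Cᵀ (by
    intro z hz
    refine hC z ?_
    rw [Matrix.mem_spectrum_iff_isRoot_charpoly] at hz ⊢
    rwa [Matrix.transpose_map, Matrix.charpoly_transpose] at hz)
  -- The solution is this series. Splitting off its term `k = 0` gives the Stein equation, and that
  -- term, `S`, makes the sum definite.
  have hsum : Summable fun k => Cᵀ ^ k * S * C ^ k := by
    refine Summable.of_norm_bounded_eventually_nat (g := fun k => ‖S‖ * q ^ k)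
      ((summable_geometric_of_lt_one hq0 hq1).mul_left _) ?_
    filter_upwards [hq, hq'] with k h1 h2
    calc ‖Cᵀ ^ k * S * C ^ k‖ ≤ ‖Cᵀ ^ k‖ * ‖S‖ * ‖C ^ k‖ :=
          (norm_mul_le _ _).trans (by gcongr; exact norm_mul_le _ _)
      _ ≤ 1 * ‖S‖ * q ^ k := by
          gcongr
          exact h2.trans (pow_le_one₀ hq0' hq1'.le)
      _ = _ := by ring
  have hrec : (∑' k, Cᵀ ^ k * S * C ^ k) = S + Cᵀ * (∑' k, Cᵀ ^ k * S * C ^ k) * C := by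
    conv_lhs => rw [hsum.tsum_eq_zero_add]
    rw [← hsum.tsum_mul_left, ← (hsum.mul_left _).tsum_mul_right]
    simp only [pow_zero, one_mul, mul_one]
    congr 2
    ext1 k
    rw [pow_succ', pow_succ C]
    simp only [mul_assoc]
  have hpsd : (∑' k, Cᵀ ^ k * S * C ^ k).PosSemidef := by
    have hterm : ∀ k, (Cᵀ ^ k * S * C ^ k).PosSemidef := fun k => by
      rw [← Matrix.transpose_pow, ← Matrix.conjTranspose_eq_transpose_of_trivial]
      exact hS.posSemidef.conjTranspose_mul_mul_same _
    refine Matrix.PosSemidef.of_dotProduct_mulVec_nonneg ?_ fun x => ?_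
    · rw [Matrix.IsHermitian, Matrix.conjTranspose_tsum]
      exact tsum_congr fun k => (hterm k).1
    · have hc : Continuous fun X : Matrix (Fin n) (Fin n) ℝ => star x ⬝ᵥ (X *ᵥ x) := by fun_prop
      refine ge_of_tendsto' ((hc.tendsto _).comp hsum.hasSum) fun s => ?_
      exact (Matrix.posSemidef_sum s fun k _ => hterm k).dotProduct_mulVec_nonneg x
  refine ⟨_, ?_, sub_eq_iff_eq_add.2 hrec⟩
  rw [hrec]
  refine hS.add_posSemidef ?_
  rw [← Matrix.conjTranspose_eq_transpose_of_trivial]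
  exact hpsd.conjTranspose_mul_mul_same C

end Lyapunov

lemma exists_mulVec_eq_of_mem_spectrum {n : ℕ} {K : Type*} [Field K] {A : Matrix (Fin n) (Fin n) K}
    {z : K} (hz : z ∈ spectrum K A) : ∃ v : Fin n → K, v ≠ 0 ∧ A *ᵥ v = z • v := by
  rw [← Matrix.spectrum_toLin', ← Module.End.hasEigenvalue_iff_mem_spectrum] at hz
  obtain ⟨v, hv⟩ := hz.exists_hasEigenvector
  exact ⟨v, hv.2, by simpa using hv.apply_eq_smul⟩

lemma mem_spectrum_of_mulVec_eq {n : ℕ} {K : Type*} [Field K] {A : Matrix (Fin n) (Fin n) K}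
    {z : K} {v : Fin n → K} (hv : v ≠ 0) (h : A *ᵥ v = z • v) : z ∈ spectrum K A := by
  rw [← Matrix.spectrum_toLin', ← Module.End.hasEigenvalue_iff_mem_spectrum]
  exact Module.End.hasEigenvalue_of_hasEigenvector (x := v)
    (Module.End.hasEigenvector_iff.2 ⟨by simpa [Module.End.mem_eigenspace_iff] using h, hv⟩)

/-- The number 1 has positive real part, so it is not an eigenvalue; the Cayley transform of `A` is
therefore defined. -/
lemma isUnit_sub_one_of_isHurwitz {n : ℕ} {A : Matrix (Fin n) (Fin n) ℝ} (hA : IsHurwitz A) :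
    IsUnit (A - 1) := by
  by_contra h
  have h1 : (1 : ℝ) ∈ spectrum ℝ A := by
    rw [spectrum.mem_iff]
    intro h'
    apply h
    rw [← IsUnit.neg_iff]
    simpa using h'
  obtain ⟨v, hv, hAv⟩ := exists_mulVec_eq_of_mem_spectrum h1
  have h2 : (1 : ℂ) ∈ spectrum ℂ (A.map (algebraMap ℝ ℂ)) := by
    refine mem_spectrum_of_mulVec_eq (v := fun i => (v i : ℂ)) (fun h => hv ?_) ?_
    · ext i; simpa using congrFun h i
    · ext i
      have := congrFun hAv i
      simp only [Matrix.mulVec, dotProduct, Pi.smul_apply, smul_eq_mul, one_mul] at this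
      simp only [Matrix.mulVec, dotProduct, Matrix.map_apply, Complex.coe_algebraMap, one_smul]
      exact_mod_cast this
  have := hA 1 h2
  norm_num at this

/-- Lyapunov's theorem: the equation `Aᵀ P + P A = -S` has a positive definite solution if `A` is
Hurwitz and `S` is positive definite. -/
theorem exists_posDef_lyapunov {n : ℕ} {A S : Matrix (Fin n) (Fin n) ℝ} (hA : IsHurwitz A)
    (hS : S.PosDef) : ∃ P : Matrix (Fin n) (Fin n) ℝ, P.PosDef ∧ Aᵀ * P + P * A = -S := by
  have hu := isUnit_sub_one_of_isHurwitz hA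
  set E := A - 1 with hE
  have hdet : IsUnit E.det := (Matrix.isUnit_iff_isUnit_det E).1 hu
  have hEE : E * E⁻¹ = 1 := Matrix.mul_nonsing_inv E hdet
  have hEE' : E⁻¹ * E = 1 := Matrix.nonsing_inv_mul E hdet
  -- Cayley transform: it carries the open left half-plane into the open unit disc.
  set C := (A + 1) * E⁻¹ with hC
  have hCE : C * E = A + 1 := by rw [hC, mul_assoc, hEE', mul_one]
  have hCspec : ∀ z ∈ spectrum ℂ (C.map (algebraMap ℝ ℂ)), ‖z‖ < 1 := by
    intro z hz
    obtain ⟨v, hv, hCv⟩ := exists_mulVec_eq_of_mem_spectrum hz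
    set Ac := A.map (algebraMap ℝ ℂ) with hAc
    set y := (E⁻¹).map (algebraMap ℝ ℂ) *ᵥ v with hy
    have hEm : E.map (algebraMap ℝ ℂ) = Ac - 1 := by
      rw [hE, Matrix.map_sub _ (by simp), Matrix.map_one _ (by simp) (by simp)]
    have hEy : Ac *ᵥ y - y = v := by
      have : (Ac - 1) *ᵥ y = v := by
        rw [hy, ← hEm, Matrix.mulVec_mulVec, ← Matrix.map_mul, hEE,
          Matrix.map_one _ (by simp) (by simp), Matrix.one_mulVec]
      rwa [Matrix.sub_mulVec, Matrix.one_mulVec] at this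
    have hCy : Ac *ᵥ y + y = z • v := by
      rw [← hCv, hC, Matrix.map_mul, ← Matrix.mulVec_mulVec, ← hy,
        Matrix.map_add _ (by simp), Matrix.map_one _ (by simp) (by simp), Matrix.add_mulVec,
        Matrix.one_mulVec]
    have hy0 : y ≠ 0 := by
      rintro h
      apply hv
      rw [← hEy, h, Matrix.mulVec_zero, sub_zero]
    -- With `v = (A - 1)y`, an eigenvalue `z` of `C` gives the eigenvalue `-(1+z)/(1-z)` of `A`,
    -- whose real part is `(|z|² - 1)/|1 - z|²`. Its negativity means `|z| < 1`.
    have key : (1 - z) • (Ac *ᵥ y) = (-(1 + z)) • y := by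
      rw [← hEy, smul_sub] at hCy
      rw [sub_smul, one_smul, neg_smul, add_smul, one_smul]
      linear_combination (exp := 1) hCy
    have hz1 : 1 - z ≠ 0 := by
      intro h
      have hz : z = 1 := (sub_eq_zero.1 h).symm
      rw [h, zero_smul, hz] at key
      have := smul_eq_zero.1 key.symm
      norm_num [hy0] at this
    have hmem : -(1 + z) / (1 - z) ∈ spectrum ℂ Ac := by
      refine mem_spectrum_of_mulVec_eq hy0 ?_
      rw [div_eq_inv_mul, mul_smul, ← key, smul_smul, inv_mul_cancel₀ hz1, one_smul]
    have hre := hA _ hmem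
    have hns : 0 < Complex.normSq (1 - z) := Complex.normSq_pos.2 hz1
    rw [Complex.div_re, ← add_div, div_lt_iff₀ hns, zero_mul] at hre
    simp at hre
    have h3 : ‖z‖ ^ 2 < 1 := by
      rw [← Complex.normSq_eq_norm_sq, Complex.normSq_apply]
      nlinarith
    nlinarith [norm_nonneg z]
  -- This weight is chosen so that congruence by `E = A - 1` turns the Stein equation into `EᵀPE -
  -- (A+1)ᵀP(A+1) = 2S`, whose left side is `-2(AᵀP + PA)`.
  have hS' : ((E⁻¹)ᵀ * ((2 : ℝ) • S) * E⁻¹).PosDef := by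
    rw [← Matrix.conjTranspose_eq_transpose_of_trivial]
    refine (hS.smul two_pos).conjTranspose_mul_mul_same ?_
    exact Matrix.mulVec_injective_of_isUnit (Matrix.isUnit_nonsing_inv_iff.2 hu)
  obtain ⟨P, hP, hPC⟩ := exists_posDef_stein C _ hCspec hS'
  refine ⟨P, hP, ?_⟩
  have h1 : Eᵀ * (P - Cᵀ * P * C) * E = (2 : ℝ) • S := by
    rw [hPC]
    have : Eᵀ * (E⁻¹)ᵀ = 1 := by rw [← Matrix.transpose_mul, hEE', Matrix.transpose_one]
    calc Eᵀ * ((E⁻¹)ᵀ * ((2 : ℝ) • S) * E⁻¹) * E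
        = (Eᵀ * (E⁻¹)ᵀ) * ((2 : ℝ) • S) * (E⁻¹ * E) := by simp only [mul_assoc]
      _ = _ := by rw [this, hEE', one_mul, mul_one]
  have h2 : Eᵀ * (P - Cᵀ * P * C) * E = Eᵀ * P * E - (C * E)ᵀ * P * (C * E) := by
    rw [Matrix.transpose_mul C E]
    noncomm_ring
  rw [h2, hCE, hE] at h1
  simp only [Matrix.transpose_sub, Matrix.transpose_add, Matrix.transpose_one] at h1
  have h3 : (2 : ℝ) • (Aᵀ * P + P * A) = (2 : ℝ) • (-S) := by
    rw [smul_neg, ← h1, two_smul]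
    noncomm_ring
  exact smul_right_injective _ (two_ne_zero) h3

/-! ### Existence of a terminal design -/

lemma continuous_feedback {n m : ℕ} (K : Matrix (Fin m) (Fin n) ℝ) : Continuous (feedback K) := by
  unfold feedback
  fun_prop

lemma contDiff_closedLoop {n m : ℕ} {f : Vec n → Vec m → Vec n}
    (hf : ContDiff ℝ 2 (fun z : Vec n × Vec m => f z.1 z.2)) (K : Matrix (Fin m) (Fin n) ℝ) :
    ContDiff ℝ 2 fun x => f x (feedback K x) := by
  have h : ContDiff ℝ 2 (feedback K) :=
    (LinearMap.toContinuousLinearMap (Matrix.toLpLin 2 2 K)).contDiff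
  exact hf.comp (contDiff_id.prodMk h)

lemma clm_apply_eq_mulVec {n k : ℕ} (D : Vec k →L[ℝ] Vec n) (x : Vec k) :
    (D x).ofLp = (Matrix.of fun i j => (D (EuclideanSpace.single j 1)) i) *ᵥ x.ofLp := by
  have hx : x = ∑ j, x j • EuclideanSpace.single j (1 : ℝ) := by
    ext i
    simp [Pi.single_apply]
  ext i
  conv_lhs => rw [hx, map_sum]
  simp [Matrix.mulVec, dotProduct, mul_comm]

/-- The linearization at the origin of `x' = f(x, Kx)` has the matrix `A + BK`. -/
lemma hasFDerivAt_closedLoop {n m : ℕ} {f : Vec n → Vec m → Vec n}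
    (hf : ContDiff ℝ 2 (fun z : Vec n × Vec m => f z.1 z.2)) (K : Matrix (Fin m) (Fin n) ℝ) :
    ∃ D : Vec n →L[ℝ] Vec n, HasFDerivAt (fun x => f x (feedback K x)) D 0 ∧
      ∀ x, (D x).ofLp = (jacA f + jacB f * K) *ᵥ x.ofLp := by
  set Kl : Vec n →L[ℝ] Vec m := LinearMap.toContinuousLinearMap (Matrix.toLpLin 2 2 K) with hKl
  have hK : ∀ x, Kl x = feedback K x := fun x => rfl
  have hK0 : feedback K 0 = 0 := by rw [← hK, map_zero]
  obtain ⟨F', hF⟩ : ∃ F', HasFDerivAt (fun z : Vec n × Vec m => f z.1 z.2) F' (0, 0) :=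
    ⟨_, ((hf.differentiable (by norm_num)) (0, 0)).hasFDerivAt⟩
  have hA : HasFDerivAt (fun x : Vec n => f x 0)
      (F'.comp ((ContinuousLinearMap.id ℝ (Vec n)).prod (0 : Vec n →L[ℝ] Vec m))) (0 : Vec n) :=
    HasFDerivAt.comp (f := fun x : Vec n => (x, (0 : Vec m))) (0 : Vec n) hF
      ((hasFDerivAt_id (0 : Vec n)).prodMk (hasFDerivAt_const (0 : Vec m) (0 : Vec n)))
  have hB : HasFDerivAt (fun u : Vec m => f 0 u)
      (F'.comp ((0 : Vec m →L[ℝ] Vec n).prod (ContinuousLinearMap.id ℝ (Vec m)))) (0 : Vec m) :=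
    HasFDerivAt.comp (f := fun u : Vec m => ((0 : Vec n), u)) (0 : Vec m) hF
      ((hasFDerivAt_const (0 : Vec n) (0 : Vec m)).prodMk (hasFDerivAt_id (0 : Vec m)))
  have hC : HasFDerivAt (fun x => f x (feedback K x))
      (F'.comp ((ContinuousLinearMap.id ℝ (Vec n)).prod Kl)) (0 : Vec n) := by
    have hF' : HasFDerivAt (fun z : Vec n × Vec m => f z.1 z.2) F' (0, feedback K 0) := by
      rwa [hK0]
    exact HasFDerivAt.comp (f := fun x : Vec n => (x, feedback K x)) (0 : Vec n) hF'
      ((hasFDerivAt_id (0 : Vec n)).prodMk Kl.hasFDerivAt)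
  refine ⟨_, hC, fun x => ?_⟩
  have hsplit : F' (x, Kl x) = F' (x, 0) + F' (0, Kl x) := by
    rw [← map_add]; simp
  have h1 := clm_apply_eq_mulVec (fderiv ℝ (fun x => f x 0) 0) x
  have h2 := clm_apply_eq_mulVec (fderiv ℝ (fun u => f 0 u) 0) (Kl x)
  have h1' : (F' (x, 0)).ofLp = jacA f *ᵥ x.ofLp := by
    rw [jacA, ← h1, hA.fderiv]; rfl
  have h2' : (F' (0, Kl x)).ofLp = jacB f *ᵥ (K *ᵥ x.ofLp) := by
    rw [hB.fderiv] at h2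
    rw [jacB, hB.fderiv]
    exact h2
  change (F' (x, Kl x)).ofLp = _
  rw [hsplit, WithLp.ofLp_add, h1', h2', Matrix.add_mulVec, Matrix.mulVec_mulVec]

lemma abs_dotProduct_mulVec_le {n : ℕ} (P : Matrix (Fin n) (Fin n) ℝ) :
    ∃ c : ℝ, 0 < c ∧ ∀ x y : Vec n, |x.ofLp ⬝ᵥ (P *ᵥ y.ofLp)| ≤ c * ‖x‖ * ‖y‖ := by
  set D : Vec n →L[ℝ] Vec n := LinearMap.toContinuousLinearMap (Matrix.toLpLin 2 2 P) with hD
  refine ⟨‖D‖ + 1, by positivity, fun x y => ?_⟩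
  have h : x.ofLp ⬝ᵥ (P *ᵥ y.ofLp) = inner ℝ (D y) x := by
    rw [EuclideanSpace.inner_eq_star_dotProduct]; rfl
  rw [h]
  calc |inner ℝ (D y) x| ≤ ‖D y‖ * ‖x‖ := abs_real_inner_le_norm _ _
    _ ≤ (‖D‖ + 1) * ‖y‖ * ‖x‖ := by
        gcongr
        exact (D.le_opNorm y).trans (by gcongr; linarith)
    _ = _ := by ring

lemma norm_le_of_wnorm_le {n : ℕ} (hn : 0 < n) {P : Matrix (Fin n) (Fin n) ℝ} (hP : P.PosDef)
    {x : Vec n} {r : ℝ} (h : wnorm P x ≤ r) : ‖x‖ ≤ r / √(lamMin P) := by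
  have hl := lamMin_pos hn hP
  have hr : 0 ≤ r := (wnorm_nonneg P x).trans h
  rw [le_div_iff₀ (Real.sqrt_pos.2 hl)]
  refine le_of_sq_le_sq ?_ hr
  rw [mul_pow, Real.sq_sqrt hl.le, mul_comm]
  refine (lamMin_mul_le_wnorm_sq hP x).trans ?_
  have := wnorm_nonneg P x
  gcongr

/-- A stable real matrix has a stability margin. -/
lemma exists_stability_margin {n : ℕ} {S : Matrix (Fin n) (Fin n) ℝ} (hS : IsHurwitz S) :
    ∃ κ : ℝ, 0 < κ ∧ ∀ z ∈ spectrum ℂ (S.map (algebraMap ℝ ℂ)), κ < -z.re := by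
  have hfin : (spectrum ℂ (S.map (algebraMap ℝ ℂ))).Finite := Matrix.finite_spectrum _
  have h : ∀ᶠ κ in 𝓝[>] (0 : ℝ), ∀ z ∈ spectrum ℂ (S.map (algebraMap ℝ ℂ)), κ < -z.re := by
    rw [hfin.eventually_all]
    intro z hz
    exact eventually_nhdsWithin_of_eventually_nhds (gt_mem_nhds (by linarith [hS z hz]))
  obtain ⟨κ, h1, h2⟩ := (h.and self_mem_nhdsWithin).exists
  exact ⟨κ, h2, h1⟩

lemma isHurwitz_add_smul_one {n : ℕ} {S : Matrix (Fin n) (Fin n) ℝ} {κ : ℝ}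
    (h : ∀ z ∈ spectrum ℂ (S.map (algebraMap ℝ ℂ)), κ < -z.re) :
    IsHurwitz (S + κ • (1 : Matrix (Fin n) (Fin n) ℝ)) := by
  intro z hz
  obtain ⟨v, hv, h1⟩ := exists_mulVec_eq_of_mem_spectrum hz
  have h2 : (κ • (1 : Matrix (Fin n) (Fin n) ℝ)).map (algebraMap ℝ ℂ) = (κ : ℂ) • 1 := by
    ext i j
    by_cases hij : i = j <;> simp [hij]
  rw [Matrix.map_add _ (by simp), h2, Matrix.add_mulVec, Matrix.smul_mulVec,
    Matrix.one_mulVec] at h1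
  have := h (z - κ) (mem_spectrum_of_mulVec_eq hv (by rw [sub_smul, ← h1]; abel))
  simp at this
  linarith

theorem exists_isTerminalDesign {n m : ℕ} (hn : 0 < n) {f : Vec n → Vec m → Vec n}
    (hf : ContDiff ℝ 2 (fun z : Vec n × Vec m => f z.1 z.2)) (hf0 : f 0 0 = 0)
    {U : Set (Vec m)} (hU : 0 ∈ interior U)
    {Q : Matrix (Fin n) (Fin n) ℝ} (hQ : Q.PosDef) {R : Matrix (Fin m) (Fin m) ℝ} (hR : R.PosDef)
    {K : Matrix (Fin m) (Fin n) ℝ} (hK : IsHurwitz (jacA f + jacB f * K)) :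
    ∃ (κ : ℝ) (P : Matrix (Fin n) (Fin n) ℝ) (ε : ℝ), IsTerminalDesign f U Q R K κ P ε := by
  obtain ⟨κ, hκ, hκ'⟩ := exists_stability_margin hK
  obtain ⟨P, hP, hlyap⟩ :=
    exists_posDef_lyapunov (isHurwitz_add_smul_one hκ') (posDef_qStar hQ hR K)
  obtain ⟨D, hD, hDA⟩ := hasFDerivAt_closedLoop hf K
  obtain ⟨c, hc, hcP⟩ := abs_dotProduct_mulVec_le P
  have hlm := lamMin_pos hn hP
  have hfb0 : feedback K 0 = 0 := by simp [feedback]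
  -- A remainder of size `η‖x‖` contributes at most `2cη‖x‖² = 2κ λ̲(P)‖x‖² ≤ 2κ‖x‖_P²`, exactly the
  -- slack left by the shift `κ`.
  set η : ℝ := κ * lamMin P / c with hη
  have hη0 : 0 < η := by positivity
  have hev1 : ∀ᶠ x in 𝓝 (0 : Vec n), ‖f x (feedback K x) - D x‖ ≤ η * ‖x‖ := by
    have := hD.isLittleO.def hη0
    simpa [hfb0, hf0] using this
  have hev2 : ∀ᶠ x in 𝓝 (0 : Vec n), feedback K x ∈ U := by
    refine (continuous_feedback K).continuousAt.eventually_mem ?_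
    rw [hfb0]
    exact mem_interior_iff_mem_nhds.1 hU
  obtain ⟨r, hr, hball⟩ := Metric.eventually_nhds_iff.1 (hev1.and hev2)
  -- The factor `1/2` puts the closed set `Ω(ε)` inside the open ball of radius `r`.
  set ε := r / 2 * √(lamMin P) with hε
  have hsq : 0 < √(lamMin P) := Real.sqrt_pos.2 hlm
  have hmem : ∀ x : Vec n, wnorm P x ≤ ε →
      ‖f x (feedback K x) - D x‖ ≤ η * ‖x‖ ∧ feedback K x ∈ U := fun x hx => by
    refine hball ?_
    rw [dist_zero_right]
    have := norm_le_of_wnorm_le hn hP hx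
    rw [hε, mul_div_cancel_right₀ _ hsq.ne'] at this
    linarith
  refine ⟨κ, P, ε, hκ, hκ', hP, hlyap, by positivity, fun x hx => (hmem x hx).2, fun x hx => ?_⟩
  have h1 := (hmem x hx).1
  set e := f x (feedback K x) - D x with he
  have h2 : (f x (feedback K x)).ofLp = (jacA f + jacB f * K) *ᵥ x.ofLp + e.ofLp := by
    rw [← hDA, ← WithLp.ofLp_add, he]; congr 1; abel
  set A := jacA f + jacB f * K with hA
  have h3 : 2 * (x.ofLp ⬝ᵥ (P *ᵥ (A *ᵥ x.ofLp)))
      = -(wnorm (qStar Q R K) x) ^ 2 - 2 * κ * wnorm P x ^ 2 := by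
    have h4 := congrArg (fun X => x.ofLp ⬝ᵥ (X *ᵥ x.ofLp)) hlyap
    simp only [Matrix.transpose_add, Matrix.transpose_smul, Matrix.transpose_one, add_mul, mul_add,
      smul_mul_assoc, mul_smul_comm, one_mul, mul_one, Matrix.add_mulVec, Matrix.neg_mulVec,
      Matrix.smul_mulVec, dotProduct_add, dotProduct_neg, dotProduct_smul, smul_eq_mul,
      ← Matrix.mulVec_mulVec] at h4
    have h5 : x.ofLp ⬝ᵥ (Aᵀ *ᵥ (P *ᵥ x.ofLp)) = x.ofLp ⬝ᵥ (P *ᵥ (A *ᵥ x.ofLp)) := by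
      have hPt : Pᵀ = P := by
        rw [← Matrix.conjTranspose_eq_transpose_of_trivial]; exact hP.1
      rw [Matrix.dotProduct_mulVec, Matrix.vecMul_transpose, Matrix.dotProduct_mulVec,
        ← Matrix.mulVec_transpose, hPt, dotProduct_comm]
    rw [wnorm_sq (posDef_qStar hQ hR K).posSemidef, wnorm_sq hP.posSemidef]
    linarith
  have h6 : x.ofLp ⬝ᵥ (P *ᵥ e.ofLp) ≤ κ * wnorm P x ^ 2 :=
    calc x.ofLp ⬝ᵥ (P *ᵥ e.ofLp) ≤ c * ‖x‖ * ‖e‖ := (le_abs_self _).trans (hcP x e)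
      _ ≤ c * ‖x‖ * (η * ‖x‖) := by gcongr
      _ = κ * (lamMin P * ‖x‖ ^ 2) := by rw [hη]; field_simp
      _ ≤ _ := by
        gcongr
        exact lamMin_mul_le_wnorm_sq hP x
  rw [h2, Matrix.mulVec_add, dotProduct_add, mul_add, h3]
  linarith

/-! ### Carathéodory solutions -/

section Solutions

variable {n m : ℕ} {F F' : ℝ → Vec n → Vec n} {a b c d : ℝ} {x y : ℝ → Vec n}

lemma IsSolution.mono (h : IsSolution F a b x) (hac : a ≤ c) (hcd : c ≤ d) (hdb : d ≤ b) :
    IsSolution F c d x := by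
  obtain ⟨h1, h2, h3⟩ := h
  have hcd' : uIcc c d ⊆ uIcc a b := by
    rw [uIcc_of_le hcd, uIcc_of_le (hac.trans (hcd.trans hdb))]
    exact Icc_subset_Icc hac hdb
  refine ⟨h1.mono (Icc_subset_Icc hac hdb), h2.mono_set hcd', fun s hs => ?_⟩
  rw [h3 s ⟨hac.trans hs.1, hs.2.trans hdb⟩, h3 c ⟨hac, hcd.trans hdb⟩, add_assoc,
    intervalIntegral.integral_add_adjacent_intervals]
  · refine h2.mono_set ?_
    rw [uIcc_of_le hac, uIcc_of_le (hac.trans (hcd.trans hdb))]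
    exact Icc_subset_Icc le_rfl (hcd.trans hdb)
  · refine h2.mono_set ?_
    rw [uIcc_of_le hs.1, uIcc_of_le (hac.trans (hcd.trans hdb))]
    exact Icc_subset_Icc hac (hs.2.trans hdb)

/-- Endpoints are null for the integral. Asking the fields to agree only on the open interval allows
a control to be redefined at a switching time. -/
lemma IsSolution.congr (h : IsSolution F a b x) (hab : a ≤ b) (hxy : EqOn y x (Icc a b))
    (hF : ∀ s ∈ Ioo a b, F' s (x s) = F s (x s)) : IsSolution F' a b y := by
  obtain ⟨h1, h2, h3⟩ := h
  have key : ∀ s ∈ Icc a b, EqOn (fun τ => F' τ (y τ)) (fun τ => F τ (x τ)) (Ioo a s) := by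
    intro s hs τ hτ
    simp only
    rw [hxy ⟨hτ.1.le, hτ.2.le.trans hs.2⟩, hF τ ⟨hτ.1, hτ.2.trans_le hs.2⟩]
  refine ⟨h1.congr hxy, ?_, fun s hs => ?_⟩
  · rw [intervalIntegrable_iff_integrableOn_Ioo_of_le hab] at h2 ⊢
    exact h2.congr_fun (key b ⟨hab, le_rfl⟩).symm measurableSet_Ioo
  · rw [hxy hs, hxy ⟨le_rfl, hab⟩, h3 s hs]
    congr 1
    rw [intervalIntegral.integral_of_le hs.1, intervalIntegral.integral_of_le hs.1,
      integral_Ioc_eq_integral_Ioo, integral_Ioc_eq_integral_Ioo]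
    exact setIntegral_congr_fun measurableSet_Ioo (key s hs).symm

lemma IsSolution.trans (h : IsSolution F a b x) (h' : IsSolution F b c x) (hab : a ≤ b)
    (hbc : b ≤ c) : IsSolution F a c x := by
  refine ⟨?_, h.2.1.trans h'.2.1, fun s hs => ?_⟩
  · rw [← Icc_union_Icc_eq_Icc hab hbc]
    exact h.1.union_of_isClosed h'.1 isClosed_Icc isClosed_Icc
  · rcases le_total s b with hsb | hsb
    · exact h.2.2 s ⟨hs.1, hsb⟩
    · rw [h'.2.2 s ⟨hsb, hs.2⟩, h.2.2 b ⟨hab, le_rfl⟩, add_assoc,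
        intervalIntegral.integral_add_adjacent_intervals h.2.1]
      refine h'.2.1.mono_set ?_
      rw [uIcc_of_le hsb, uIcc_of_le hbc]
      exact Icc_subset_Icc le_rfl hs.2

lemma isSolution_self (F : ℝ → Vec n → Vec n) (a : ℝ) (x : ℝ → Vec n) : IsSolution F a a x := by
  refine ⟨by simp, by simp, fun s hs => ?_⟩
  rw [Icc_self, mem_singleton_iff] at hs
  simp [hs]

/-- Continuity on all of `ℝ` makes primitives differentiable from both sides, also at the endpoints.
-/
lemma exists_continuous_eqOn {E : Type*} [TopologicalSpace E] {φ : ℝ → E} (hab : a ≤ b)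
    (hφ : ContinuousOn φ (Icc a b)) : ∃ ψ : ℝ → E, Continuous ψ ∧ EqOn ψ φ (Icc a b) :=
  ⟨IccExtend hab ((Icc a b).domRestrict φ), (continuousOn_iff_continuous_domRestrict.1 hφ).Icc_extend',
    fun _ hs => IccExtend_of_mem hab _ hs⟩

/-- Picard's theorem on an interval so short that the integral operator is a contraction. -/
lemma exists_isSolution_of_mul_lt_one {L : ℝ} (hL : 0 ≤ L) (hab : a ≤ b) (hLab : L * (b - a) < 1)
    (hLip : ∀ s ∈ Icc a b, ∀ x y, ‖F s x - F s y‖ ≤ L * ‖x - y‖)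
    (hint : ∀ x : ℝ → Vec n, Continuous x → IntervalIntegrable (fun s => F s (x s)) volume a b)
    (x₀ : Vec n) : ∃ x : ℝ → Vec n, x a = x₀ ∧ IsSolution F a b x := by
  set ext : C(Icc a b, Vec n) → ℝ → Vec n := fun γ => IccExtend hab γ with hext
  have hec : ∀ γ, Continuous (ext γ) := fun γ => γ.continuous.Icc_extend'
  have hint' : ∀ γ, ∀ s ∈ Icc a b, IntervalIntegrable (fun τ => F τ (ext γ τ)) volume a s :=
    fun γ s hs => (hint _ (hec γ)).mono_set (by
      rw [uIcc_of_le hs.1, uIcc_of_le hab]; exact Icc_subset_Icc le_rfl hs.2)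
  have hΦc : ∀ γ, ContinuousOn (fun s => x₀ + ∫ τ in a..s, F τ (ext γ τ)) (Icc a b) := by
    intro γ
    refine continuousOn_const.add ?_
    have := intervalIntegral.continuousOn_primitive_interval'
      (μ := volume) (hint _ (hec γ)) (left_mem_uIcc)
    rwa [uIcc_of_le hab] at this
  set Φ : C(Icc a b, Vec n) → C(Icc a b, Vec n) := fun γ =>
    ⟨(Icc a b).domRestrict fun s => x₀ + ∫ τ in a..s, F τ (ext γ τ),
      continuousOn_iff_continuous_domRestrict.1 (hΦc γ)⟩ with hΦ
  have hK0 : 0 ≤ L * (b - a) := mul_nonneg hL (sub_nonneg.2 hab)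
  have hcontr : ContractingWith ⟨L * (b - a), hK0⟩ Φ := by
    refine ⟨by exact_mod_cast hLab, LipschitzWith.of_dist_le_mul fun γ γ' => ?_⟩
    rw [ContinuousMap.dist_le (by positivity)]
    rintro ⟨s, hs⟩
    change dist (x₀ + ∫ τ in a..s, F τ (ext γ τ)) (x₀ + ∫ τ in a..s, F τ (ext γ' τ)) ≤
      L * (b - a) * dist γ γ'
    rw [dist_add_left, dist_eq_norm, ← intervalIntegral.integral_sub (hint' γ s hs) (hint' γ' s hs)]
    calc ‖∫ τ in a..s, (F τ (ext γ τ) - F τ (ext γ' τ))‖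
        ≤ (L * dist γ γ') * |s - a| := by
          refine intervalIntegral.norm_integral_le_of_norm_le_const fun τ hτ => ?_
          rw [uIoc_of_le hs.1] at hτ
          have hτ' : τ ∈ Icc a b := ⟨hτ.1.le, hτ.2.trans hs.2⟩
          refine (hLip τ hτ' _ _).trans ?_
          gcongr
          rw [← dist_eq_norm]
          exact ContinuousMap.dist_apply_le_dist _
      _ ≤ (L * dist γ γ') * (b - a) := by
          rw [abs_of_nonneg (sub_nonneg.2 hs.1)]
          gcongr
          exact hs.2
      _ = _ := by ring
  have : Nonempty C(Icc a b, Vec n) := ⟨0⟩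
  set γ := ContractingWith.fixedPoint Φ hcontr
  have hγ : Φ γ = γ := hcontr.fixedPoint_isFixedPt
  have heq : ∀ s ∈ Icc a b, ext γ s = x₀ + ∫ τ in a..s, F τ (ext γ τ) := by
    intro s hs
    have h1 : ext γ s = γ ⟨s, hs⟩ := IccExtend_of_mem hab _ hs
    rw [h1]
    conv_lhs => rw [← hγ]
    rfl
  have ha : ext γ a = x₀ := by simpa using heq a ⟨le_rfl, hab⟩
  refine ⟨ext γ, ha, (hec γ).continuousOn, hint _ (hec γ), fun s hs => ?_⟩
  rw [ha]
  exact heq s hs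

theorem exists_isSolution {L : ℝ} (hL : 0 ≤ L) (hab : a ≤ b)
    (hLip : ∀ s ∈ Icc a b, ∀ x y, ‖F s x - F s y‖ ≤ L * ‖x - y‖)
    (hint : ∀ x : ℝ → Vec n, Continuous x → IntervalIntegrable (fun s => F s (x s)) volume a b)
    (x₀ : Vec n) : ∃ x : ℝ → Vec n, x a = x₀ ∧ IsSolution F a b x := by
  -- A step length with `L * d < 1`, independent of the state because the Lipschitz constant is
  -- global; finitely many Picard steps are glued.
  set d := 1 / (L + 1) with hd
  have hd0 : 0 < d := by positivity
  have hLd : L * d < 1 := by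
    rw [hd, mul_one_div, div_lt_one (by positivity)]
    linarith
  have key : ∀ k : ℕ, ∀ c ∈ Icc a b, c - a ≤ k * d →
      ∃ x : ℝ → Vec n, x a = x₀ ∧ IsSolution F a c x := by
    intro k
    induction k with
    | zero =>
      intro c hc hca
      obtain rfl : c = a := le_antisymm (by simpa using hca) hc.1
      exact ⟨fun _ => x₀, rfl, isSolution_self _ _ _⟩
    | succ k ih =>
      intro c hc hca
      push_cast at hca
      have hc' : max a (c - d) ∈ Icc a b :=
        ⟨le_max_left _ _, max_le hab (by linarith [hc.2])⟩
      have hcc : max a (c - d) ≤ c := max_le hc.1 (by linarith)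
      set c' := max a (c - d)
      have hcd : c - d ≤ c' := le_max_right _ _
      obtain ⟨x, hxa, hx⟩ := ih c' hc' (by
        rw [sub_le_iff_le_add]
        exact max_le (by have : (0 : ℝ) ≤ k * d := by positivity
                         linarith) (by linarith))
      obtain ⟨y, hya, hy⟩ := exists_isSolution_of_mul_lt_one (F := F) hL hcc
        (lt_of_le_of_lt (by gcongr; linarith) hLd)
        (fun s hs => hLip s ⟨hc'.1.trans hs.1, hs.2.trans hc.2⟩)
        (fun z hz => (hint z hz).mono_set (by
          rw [uIcc_of_le hcc, uIcc_of_le hab]; exact Icc_subset_Icc hc'.1 hc.2)) (x c')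
      have e1 : EqOn (fun s => if s ≤ c' then x s else y s) x (Icc a c') := fun s hs => by
        simp [hs.2]
      have e2 : EqOn (fun s => if s ≤ c' then x s else y s) y (Icc c' c) := fun s hs => by
        rcases hs.1.eq_or_lt with rfl | h
        · simp [hya]
        · simp [not_le.2 h]
      refine ⟨fun s => if s ≤ c' then x s else y s, by simp [hc'.1, hxa], ?_⟩
      exact (hx.congr hc'.1 e1 fun _ _ => rfl).trans (hy.congr hcc e2 fun _ _ => rfl) hc'.1 hcc
  obtain ⟨k, hk⟩ := exists_nat_ge ((b - a) / d)
  exact key k b ⟨hab, le_rfl⟩ ((div_le_iff₀ hd0).1 hk)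

/-- Grönwall's inequality in integral form. -/
lemma le_gronwallBound_of_le_integral {φ : ℝ → ℝ} {δ L r : ℝ} (hL : 0 ≤ L)
    (hφ : ContinuousOn φ (Icc a b))
    (h : ∀ s ∈ Icc a b, φ s ≤ δ + ∫ τ in a..s, (L * φ τ + r)) :
    ∀ s ∈ Icc a b, φ s ≤ gronwallBound δ L r (s - a) := by
  intro s hs
  have hab := hs.1.trans hs.2
  obtain ⟨ψ, hψ, hψφ⟩ := exists_continuous_eqOn hab hφ
  have hcont : Continuous fun τ => L * ψ τ + r := by fun_prop
  have h' : ∀ s ∈ Icc a b, φ s ≤ δ + ∫ τ in a..s, (L * ψ τ + r) := by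
    intro s hs
    refine (h s hs).trans_eq ?_
    congr 1
    refine intervalIntegral.integral_congr fun τ hτ => ?_
    rw [uIcc_of_le hs.1] at hτ
    rw [hψφ ⟨hτ.1, hτ.2.trans hs.2⟩]
  -- The differential Grönwall inequality is applied to the integral majorant, which is
  -- differentiable even where `φ` is not.
  have hder : ∀ s, HasDerivAt (fun s => δ + ∫ τ in a..s, (L * ψ τ + r)) (L * ψ s + r) s :=
    fun s => (hcont.integral_hasStrictDerivAt a s).hasDerivAt.const_add δ
  refine (h' s hs).trans (le_gronwallBound_of_liminf_deriv_right_le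
    (f := fun s => δ + ∫ τ in a..s, (L * ψ τ + r)) (f' := fun s => L * ψ s + r)
    (fun s _ => (hder s).continuousAt.continuousWithinAt)
    (fun s _ r hr => (hder s).hasDerivWithinAt.liminf_right_slope_le hr) (by simp)
    (fun s hs' => ?_) s hs)
  have hs'' := Ico_subset_Icc_self hs'
  have := h' s hs''
  rw [hψφ hs'']
  gcongr

lemma IsSolution.norm_sub_le {L r : ℝ} (hL : 0 ≤ L) (hx : IsSolution F a b x)
    (hy : IsSolution F' a b y)
    (h : ∀ s ∈ Icc a b, ‖F s (x s) - F' s (y s)‖ ≤ L * ‖x s - y s‖ + r) :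
    ∀ s ∈ Icc a b, ‖x s - y s‖ ≤ gronwallBound ‖x a - y a‖ L r (s - a) := by
  refine le_gronwallBound_of_le_integral hL (hx.1.sub hy.1).norm fun s hs => ?_
  have hab := hs.1.trans hs.2
  have hsub : uIcc a s ⊆ uIcc a b := by
    rw [uIcc_of_le hs.1, uIcc_of_le hab]; exact Icc_subset_Icc le_rfl hs.2
  have hcont : ContinuousOn (fun τ => L * ‖x τ - y τ‖ + r) (uIcc a s) := by
    rw [uIcc_of_le hab] at hsub
    exact ((continuousOn_const.mul (hx.1.sub hy.1).norm).add continuousOn_const).mono hsub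
  rw [hx.2.2 s hs, hy.2.2 s hs, add_sub_add_comm,
    ← intervalIntegral.integral_sub (hx.2.1.mono_set hsub) (hy.2.1.mono_set hsub)]
  refine (norm_add_le _ _).trans ?_
  gcongr
  refine intervalIntegral.norm_integral_le_of_norm_le hs.1 (.of_forall fun τ hτ => ?_)
    hcont.intervalIntegrable
  exact h τ ⟨hτ.1.le, hτ.2.trans hs.2⟩

lemma IsSolution.hasDerivWithinAt {g : Vec n → Vec n} (hg : Continuous g)
    (hx : IsSolution (fun _ => g) a b x) {s : ℝ} (hs : s ∈ Ico a b) :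
    HasDerivWithinAt x (g (x s)) (Ici s) s := by
  have hab := (hs.1.trans_lt hs.2).le
  obtain ⟨ψ, hψ, hψx⟩ := exists_continuous_eqOn hab hx.1
  have hder : HasDerivAt (fun s => x a + ∫ τ in a..s, g (ψ τ)) (g (ψ s)) s :=
    ((hg.comp hψ).integral_hasStrictDerivAt a s).hasDerivAt.const_add (x a)
  have heq : ∀ s ∈ Icc a b, x s = x a + ∫ τ in a..s, g (ψ τ) := by
    intro s hs
    rw [hx.2.2 s hs]
    congr 1
    refine intervalIntegral.integral_congr fun τ hτ => ?_
    rw [uIcc_of_le hs.1] at hτ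
    simp only
    rw [hψx ⟨hτ.1, hτ.2.trans hs.2⟩]
  rw [hψx (Ico_subset_Icc_self hs)] at hder
  refine hder.hasDerivWithinAt.congr_of_eventuallyEq ?_ (heq s (Ico_subset_Icc_self hs))
  filter_upwards [Icc_mem_nhdsGE hs.2] with τ hτ
  exact heq τ ⟨hs.1.trans hτ.1, hτ.2⟩

lemma PiecewiseRightContinuous.intervalIntegrable {f : Vec n → Vec m → Vec n}
    (hf : Continuous fun z : Vec n × Vec m => f z.1 z.2) {U : Set (Vec m)} (hU : IsCompact U)
    {u : ℝ → Vec m} (hu : PiecewiseRightContinuous u a b) (hab : a ≤ b)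
    (huU : ∀ s ∈ Icc a b, u s ∈ U) (hx : ContinuousOn x (Icc a b)) :
    IntervalIntegrable (fun s => f (x s) (u s)) volume a b := by
  rw [intervalIntegrable_iff_integrableOn_Ioo_of_le hab]
  -- Off this finite, hence null, set the integrand is continuous; it is bounded because states and
  -- inputs range over compact sets.
  set D := {s ∈ Ioo a b | ¬ ContinuousAt u s} with hD
  have hDfin : D.Finite := hu.2.2
  have hcont : ContinuousOn (fun s => f (x s) (u s)) (Ioo a b \ D) := by
    refine hf.comp_continuousOn (ContinuousOn.prodMk
      (hx.mono (sdiff_subset.trans Ioo_subset_Icc_self)) fun s hs => ?_)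
    have : ContinuousAt u s := by
      by_contra h
      exact hs.2 ⟨hs.1, h⟩
    exact this.continuousWithinAt
  have hmeas : MeasurableSet (Ioo a b \ D) := measurableSet_Ioo.diff hDfin.measurableSet
  have hae : (Ioo a b \ D : Set ℝ) =ᵐ[volume] Ioo a b :=
    sdiff_null_ae_eq_self (hDfin.measure_zero _)
  rw [← integrableOn_congr_set_ae hae]
  obtain ⟨C, hC⟩ :=
    (((isCompact_Icc.image_of_continuousOn hx).prod hU).image hf).isBounded.exists_norm_le
  refine IntegrableOn.of_bound ((measure_mono sdiff_subset).trans_lt measure_Ioo_lt_top)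
    (hcont.aestronglyMeasurable hmeas) C ?_
  filter_upwards [ae_restrict_mem hmeas] with s hs
  have hs' := Ioo_subset_Icc_self hs.1
  exact hC _ ⟨(x s, u s), ⟨mem_image_of_mem x hs', huU s hs'⟩, rfl⟩

end Solutions

/-! ### The terminal phase -/

lemma hasDerivWithinAt_wnorm_sq {n : ℕ} {P : Matrix (Fin n) (Fin n) ℝ} (hP : P.PosDef)
    {x : ℝ → Vec n} {v : Vec n} {s : ℝ} {S : Set ℝ} (hx : HasDerivWithinAt x v S s) :
    HasDerivWithinAt (fun τ => wnorm P (x τ) ^ 2) (2 * ((x s).ofLp ⬝ᵥ (P *ᵥ v.ofLp))) S s := by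
  set D : Vec n →L[ℝ] Vec n := LinearMap.toContinuousLinearMap (Matrix.toLpLin 2 2 P)
  have hin : ∀ y z : Vec n, inner ℝ (D y) z = z.ofLp ⬝ᵥ (P *ᵥ y.ofLp) := fun y z => by
    rw [EuclideanSpace.inner_eq_star_dotProduct]; rfl
  have hsymm : ∀ y z : Vec n, y.ofLp ⬝ᵥ (P *ᵥ z.ofLp) = z.ofLp ⬝ᵥ (P *ᵥ y.ofLp) := fun y z => by
    have hPt : Pᵀ = P := by
      rw [← Matrix.conjTranspose_eq_transpose_of_trivial]; exact hP.1
    rw [Matrix.dotProduct_mulVec, ← Matrix.mulVec_transpose, hPt, dotProduct_comm]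
  have h := (D.hasFDerivAt.comp_hasDerivWithinAt s hx).inner ℝ hx
  have e : (fun τ => wnorm P (x τ) ^ 2) = fun τ => inner ℝ (D (x τ)) (x τ) := by
    ext τ
    rw [wnorm_sq hP.posSemidef, hin]
  rw [e]
  refine h.congr_deriv ?_
  rw [Function.comp_apply, hin, hin, hsymm v (x s)]
  ring

/-- From any state of the terminal set, the closed loop `x' = f(x, Kx)` has a trajectory that stays
in the terminal set and decays exponentially. -/
theorem IsTerminalDesign.exists_trajectory {n m : ℕ} (hn : 0 < n) {f : Vec n → Vec m → Vec n}
    (hf : ContDiff ℝ 2 (fun z : Vec n × Vec m => f z.1 z.2)) {U : Set (Vec m)}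
    {Q : Matrix (Fin n) (Fin n) ℝ} (hQ : Q.PosDef) {R : Matrix (Fin m) (Fin m) ℝ} (hR : R.PosDef)
    {K : Matrix (Fin m) (Fin n) ℝ} {κ : ℝ} {P : Matrix (Fin n) (Fin n) ℝ} {ε : ℝ}
    (hd : IsTerminalDesign f U Q R K κ P ε) {ξ : Vec n} (hξ : wnorm P ξ ≤ ε) {a b : ℝ}
    (hab : a ≤ b) :
    ∃ z : ℝ → Vec n, Continuous z ∧ z a = ξ ∧ IsSolution (fun _ x => f x (feedback K x)) a b z ∧
      ∀ s ∈ Icc a b, wnorm P (z s) ≤ ε ∧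
        wnorm P (z s) ≤ ε * Real.exp (-(lamMin (qStar Q R K) / lamMax P / 2) * (s - a)) := by
  have hP := hd.posDef
  have hε := hd.eps_pos
  have hQs := posDef_qStar hQ hR K
  have hlP := lamMin_pos hn hP
  have hr : 0 < ε / √(lamMin P) := div_pos hε (Real.sqrt_pos.2 hlP)
  -- The closed-loop field need not be globally Lipschitz. The cutoff equals 1 on a ball containing
  -- `Ω(ε)`, and the truncated field is `C¹` with compact support, hence Lipschitz.
  set χ : ContDiffBump (0 : Vec n) := ⟨ε / √(lamMin P), ε / √(lamMin P) + 1, hr, by linarith⟩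
  set g : Vec n → Vec n := fun x => χ x • f x (feedback K x) with hg
  have hgf : ∀ x, wnorm P x ≤ ε → g x = f x (feedback K x) := fun x hx => by
    have : χ x = 1 := χ.one_of_mem_closedBall (by
      rw [mem_closedBall_zero_iff]
      exact norm_le_of_wnorm_le hn hP hx)
    rw [hg]
    simp only [this, one_smul]
  have hgd : ContDiff ℝ 1 g := χ.contDiff.smul ((contDiff_closedLoop hf K).of_le (by norm_num))
  obtain ⟨C, hC⟩ := hgd.lipschitzWith_of_hasCompactSupport χ.hasCompactSupport.smul_right
    one_ne_zero
  obtain ⟨z₀, hz₀a, hz₀⟩ := exists_isSolution (F := fun _ => g) C.2 hab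
    (fun _ _ x y => by simpa [dist_eq_norm] using hC.dist_le_mul x y)
    (fun x hx => (hgd.continuous.comp hx).intervalIntegrable _ _) ξ
  obtain ⟨z, hzc, hzz⟩ := exists_continuous_eqOn hab hz₀.1
  have hz : IsSolution (fun _ => g) a b z := hz₀.congr hab hzz fun _ _ => rfl
  have hza : z a = ξ := by rw [hzz ⟨le_rfl, hab⟩, hz₀a]
  have hder : ∀ s ∈ Ico a b, HasDerivWithinAt (fun τ => wnorm P (z τ) ^ 2)
      (2 * ((z s).ofLp ⬝ᵥ (P *ᵥ (g (z s)).ofLp))) (Ici s) s := fun s hs =>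
    hasDerivWithinAt_wnorm_sq hP (hz.hasDerivWithinAt hgd.continuous hs)
  have hVc : ContinuousOn (fun τ => wnorm P (z τ) ^ 2) (Icc a b) :=
    (((continuous_wnorm P).comp hzc).pow 2).continuousOn
  have hV0 : wnorm P (z a) ^ 2 ≤ ε ^ 2 := by
    rw [hza]
    exact pow_le_pow_left₀ (wnorm_nonneg _ _) hξ 2
  -- On the boundary of `Ω(ε)` the state is nonzero, so `V = ‖z‖_P²` strictly decreases there and no
  -- trajectory can leave.
  have hinv : ∀ s ∈ Icc a b, wnorm P (z s) ≤ ε := by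
    intro s hs
    refine le_of_sq_le_sq ?_ hε.le
    refine image_le_of_liminf_slope_right_lt_deriv_boundary hVc
      (fun s hs r hr => (hder s hs).liminf_right_slope_le hr) (B := fun _ => ε ^ 2)
      (B' := fun _ => 0) hV0 (fun s => hasDerivAt_const s _) (fun s hs hsε => ?_) hs
    have hw : wnorm P (z s) = ε := (pow_left_inj₀ (wnorm_nonneg _ _) hε.le two_ne_zero).1 hsε
    rw [hgf _ hw.le]
    refine (hd.decrease _ hw.le).trans_lt ?_
    have hz0 : z s ≠ 0 := fun h => by
      rw [h, wnorm_zero] at hw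
      exact hε.ne hw
    have := wnorm_pos hQs hz0
    rw [neg_lt_zero]
    positivity
  have hlQ := lamMin_pos hn hQs
  have hLP := lamMax_pos hn hP
  refine ⟨z, hzc, hza, hz.congr hab (fun _ _ => rfl)
    (fun s hs => (hgf _ (hinv s (Ioo_subset_Icc_self hs))).symm), fun s hs => ⟨hinv s hs, ?_⟩⟩
  -- Inside `Ω(ε)`, `V' ≤ -‖z‖²_{Q*} ≤ -(λ̲(Q*)/λ̄(P)) V`; taking the square root halves the rate.
  have hdecay := le_gronwallBound_of_liminf_deriv_right_le hVc
      (fun s hs r hr => (hder s hs).liminf_right_slope_le hr) hV0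
      (K := -(lamMin (qStar Q R K) / lamMax P)) (ε := 0) (fun s hs => by
        have hw := hinv s (Ico_subset_Icc_self hs)
        rw [hgf _ hw, add_zero, neg_mul]
        refine (hd.decrease _ hw).trans (neg_le_neg ?_)
        refine le_trans ?_ (lamMin_mul_le_wnorm_sq hQs (z s))
        rw [div_mul_eq_mul_div, div_le_iff₀ hLP, mul_assoc]
        gcongr
        rw [mul_comm]
        exact wnorm_sq_le hP _) s hs
  rw [gronwallBound_ε0] at hdecay
  refine le_of_sq_le_sq (hdecay.trans_eq ?_) (by positivity)
  rw [mul_pow, ← Real.exp_nat_mul]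
  congr 2
  push_cast
  ring

/-! ### Feasibility of the shifted control -/

/-- On `[0, b]` the convex exponential lies below its chord, which descends from 1 to at most `α`;
beyond `b` it is at most `α`. -/
lemma exp_neg_le_of_exp_neg_le {c b τ h α : ℝ} (hc : 0 ≤ c) (hb : 0 < b) (hα : α ≤ 1)
    (hcb : Real.exp (-c * b) ≤ α) (hτ : 0 ≤ τ) (hτh : τ ≤ h) (hbh : b ≤ h) :
    Real.exp (-c * τ) ≤ α + (h - τ) / b * (1 - α) := by
  rcases le_total τ b with h1 | h1
  · have hconv := convexOn_exp.2 (mem_univ (0 : ℝ)) (mem_univ (-c * b))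
      (show 0 ≤ 1 - τ / b by rw [sub_nonneg, div_le_one hb]; exact h1)
      (show 0 ≤ τ / b by positivity) (by ring)
    simp only [smul_eq_mul, mul_zero, zero_add, Real.exp_zero, mul_one] at hconv
    rw [show τ / b * (-c * b) = -c * τ by field_simp] at hconv
    have h2 : τ / b * Real.exp (-c * b) ≤ τ / b * α := by gcongr
    have h3 : (b - τ) / b * (1 - α) ≤ (h - τ) / b * (1 - α) := by
      have : 0 ≤ 1 - α := by linarith
      gcongr
    have h4 : (b - τ) / b = 1 - τ / b := by field_simp
    rw [h4] at h3
    linarith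
  · have h2 : Real.exp (-c * τ) ≤ Real.exp (-c * b) := by
      apply Real.exp_le_exp.2
      nlinarith
    have h3 : 0 ≤ (h - τ) / b * (1 - α) :=
      mul_nonneg (div_nonneg (by linarith) hb.le) (by linarith)
    linarith

/-- Applying the old control until the end of its horizon and the terminal feedback afterwards is
feasible at time `t + h`, if the state there is close enough to the predicted one. -/
theorem exists_isFeasible_shift {n m : ℕ} (hn : 0 < n) {f : Vec n → Vec m → Vec n}
    (hf : ContDiff ℝ 2 (fun z : Vec n × Vec m => f z.1 z.2)) {U : Set (Vec m)} (hU : IsCompact U)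
    {L : ℝ} (hL : 0 < L) (hLip : ∀ u ∈ U, ∀ x y : Vec n, ‖f x u - f y u‖ ≤ L * ‖x - y‖)
    {Q : Matrix (Fin n) (Fin n) ℝ} (hQ : Q.PosDef) {R : Matrix (Fin m) (Fin m) ℝ} (hR : R.PosDef)
    {K : Matrix (Fin m) (Fin n) ℝ} {κ : ℝ} {P : Matrix (Fin n) (Fin n) ℝ} {ε : ℝ}
    (hd : IsTerminalDesign f U Q R K κ P ε) {α β T M ρ : ℝ} (hα : 0 < α) (hα1 : α < 1)
    (hβ : 0 < β) (hT : 0 < T) (hρ : 0 ≤ ρ)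
    (hρε : lamMax (CFC.sqrt P) * (ρ / L * Real.exp (L * T)) ≤ (1 - α) * ε)
    (hM : 1 - α ≤ β * (M - 1) * α)
    (hTα : Real.exp (-(lamMin (qStar Q R K) / lamMax P / 2) * (β * T)) ≤ α)
    {t h : ℝ} (hh : β * T ≤ h) (hhT : h ≤ T) {ξ ξ' : Vec n} {u : ℝ → Vec m} {y : ℝ → Vec n}
    (huy : MPCProblem.IsFeasible ⟨f, U, Q, R, P, T, M, α, ε⟩ t ξ u y)
    (hξ' : ‖ξ' - y (t + h)‖ ≤ ρ / L * (Real.exp (L * h) - 1)) :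
    ∃ v z, MPCProblem.IsFeasible ⟨f, U, Q, R, P, T, M, α, ε⟩ (t + h) ξ' v z := by
  obtain ⟨huc, huU, hyξ, hys, hyr⟩ := huy
  simp only at huc huU hys hyr
  have hP := hd.posDef
  have hε := hd.eps_pos
  have hl := lamMax_pos hn (posDef_sqrt hP)
  have hh0 : 0 < h := (mul_pos hβ hT).trans_le hh
  have hte : t + h ≤ t + T := by linarith
  have het : t + T ≤ t + h + T := by linarith
  have hM1 : 0 ≤ M - 1 := by
    by_contra hneg
    have : β * (M - 1) * α < 0 := mul_neg_of_neg_of_pos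
      (mul_neg_of_pos_of_neg hβ (not_le.1 hneg)) hα
    linarith
  have hsub : Icc (t + h) (t + T) ⊆ Icc t (t + T) := Icc_subset_Icc (by linarith) le_rfl
  have hys' := hys.mono (c := t + h) (d := t + T) (by linarith) hte le_rfl
  have huc' : PiecewiseRightContinuous u (t + h) (t + T) :=
    ⟨fun s hs => huc.1 s ⟨by linarith [hs.1], hs.2⟩, fun s hs => huc.2.1 s ⟨by linarith [hs.1], hs.2⟩,
      huc.2.2.subset fun s hs => ⟨⟨by linarith [hs.1.1], hs.1.2⟩, hs.2⟩⟩
  obtain ⟨z₁, hz₁0, hz₁⟩ := exists_isSolution (F := fun s z => f z (u s)) hL.le hte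
    (fun s hs => hLip _ (huU s (hsub hs)))
    (fun x hx => huc'.intervalIntegrable hf.continuous hU hte (fun s hs => huU s (hsub hs))
      hx.continuousOn) ξ'
  -- The error at `t + h` grows at most by `e^{L(s-t-h)}`, so the total exponent is `L(s - t) ≤ LT`.
  have herr : ∀ s ∈ Icc (t + h) (t + T), wnorm P (z₁ s - y s) ≤ (1 - α) * ε := by
    intro s hs
    have h1 := hz₁.norm_sub_le (r := 0) hL.le hys' (fun τ hτ => by
      rw [add_zero]; exact hLip _ (huU τ (hsub hτ)) _ _) s hs
    rw [gronwallBound_ε0, hz₁0] at h1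
    refine (wnorm_le hP _).trans (le_trans ?_ hρε)
    gcongr
    refine h1.trans ?_
    calc ‖ξ' - y (t + h)‖ * Real.exp (L * (s - (t + h)))
        ≤ ρ / L * Real.exp (L * h) * Real.exp (L * (s - (t + h))) := by
          gcongr
          exact hξ'.trans (by gcongr; linarith)
      _ = ρ / L * Real.exp (L * (s - t)) := by
          rw [mul_assoc, ← Real.exp_add]
          congr 2
          ring
      _ ≤ _ := by
          gcongr
          linarith [hs.2]
  have hz₁w : ∀ s ∈ Icc (t + h) (t + T), wnorm P (z₁ s) ≤ wnorm P (y s) + (1 - α) * ε :=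
    fun s hs => by
      have := wnorm_add_le hP (y s) (z₁ s - y s)
      rw [add_sub_cancel] at this
      linarith [herr s hs]
  have hterm : wnorm P (z₁ (t + T)) ≤ ε := by
    have h1 := hz₁w (t + T) ⟨hte, le_rfl⟩
    have h2 := hyr (t + T) ⟨by linarith, le_rfl⟩
    rw [show ((t + T - (t + T)) * M + (t + T) - t) / T * (α * ε) = α * ε by field_simp; ring] at h2
    linarith
  obtain ⟨z₂, hz₂c, hz₂0, hz₂, hz₂w⟩ := hd.exists_trajectory hn hf hQ hR hterm het
  have hfc : Continuous fun s => feedback K (z₂ s) := (continuous_feedback K).comp hz₂c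
  have e1 : EqOn (fun s => if s ≤ t + T then z₁ s else z₂ s) z₁ (Icc (t + h) (t + T)) :=
    fun s hs => if_pos hs.2
  have e2 : EqOn (fun s => if s ≤ t + T then z₁ s else z₂ s) z₂ (Icc (t + T) (t + h + T)) :=
    fun s hs => by
      rcases hs.1.eq_or_lt with rfl | h
      · simp [hz₂0]
      · simp [not_le.2 h]
  have hvlt : ∀ {s}, s < t + T →
      (fun s => if s < t + T then u s else feedback K (z₂ s)) =ᶠ[𝓝 s] u := fun hs => by
    filter_upwards [gt_mem_nhds hs] with τ hτ
    exact if_pos hτ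
  have hvgt : ∀ {s}, t + T < s → (fun s => if s < t + T then u s else feedback K (z₂ s))
      =ᶠ[𝓝 s] fun s => feedback K (z₂ s) := fun hs => by
    filter_upwards [lt_mem_nhds hs] with τ hτ
    exact if_neg hτ.not_gt
  -- The strict inequality gives the control its feedback value at `t + T`, as right-continuity
  -- demands; the two state pieces agree there.
  refine ⟨fun s => if s < t + T then u s else feedback K (z₂ s),
    fun s => if s ≤ t + T then z₁ s else z₂ s, ⟨⟨?_, ?_, ?_⟩, ?_, ?_, ?_, ?_⟩⟩
  · intro s hs
    rcases lt_or_ge s (t + T) with hsT | hsT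
    · exact (huc'.1 s ⟨hs.1, hsT⟩).congr_of_eventuallyEq
        ((hvlt hsT).filter_mono nhdsWithin_le_nhds) (if_pos hsT)
    · exact hfc.continuousWithinAt.congr (fun τ hτ => if_neg (hsT.trans hτ).not_gt)
        (if_neg hsT.not_gt)
  · intro s hs
    rcases le_or_gt s (t + T) with hsT | hsT
    · obtain ⟨l, hl⟩ := huc'.2.1 s ⟨hs.1, hsT⟩
      refine ⟨l, hl.congr' ?_⟩
      filter_upwards [self_mem_nhdsWithin] with τ hτ
      exact (if_pos (lt_of_lt_of_le hτ hsT)).symm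
    · exact ⟨_, ((hfc.tendsto s).mono_left nhdsWithin_le_nhds).congr'
        ((hvgt hsT).symm.filter_mono nhdsWithin_le_nhds)⟩
  · refine (huc'.2.2.union (finite_singleton (t + T))).subset ?_
    rintro s ⟨hs, hns⟩
    rcases lt_trichotomy s (t + T) with hsT | hsT | hsT
    · exact Or.inl ⟨⟨hs.1, hsT⟩, fun hc => hns (hc.congr (hvlt hsT).symm)⟩
    · exact Or.inr hsT
    · exact absurd (hfc.continuousAt.congr (hvgt hsT).symm) hns
  · intro s hs
    simp only at hs ⊢
    split_ifs with hsT
    · exact huU s (hsub ⟨hs.1, hsT.le⟩)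
    · exact hd.admissible _ (hz₂w s ⟨not_lt.1 hsT, hs.2⟩).1
  · simp only [hte, if_true, hz₁0]
  · refine (hz₁.congr hte e1 fun s hs => ?_).trans (hz₂.congr het e2 fun s hs => ?_) hte het
    · simp only [hs.2, if_true]
    · simp only [hs.1.not_gt, if_false]
  · intro s hs
    simp only at hs ⊢
    have hαε : 0 < α * ε := mul_pos hα hε
    rcases le_total s (t + T) with hsT | hsT
    · have hs' : s ∈ Icc (t + h) (t + T) := ⟨hs.1, hsT⟩
      rw [if_pos hsT]
      have h1 := hyr s (hsub hs')
      -- The right side is the amount by which the constraint at a fixed time is relaxed when its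
      -- window moves by `h`.
      have h2 : (1 - α) * ε ≤ h / T * ((M - 1) * (α * ε)) :=
        calc (1 - α) * ε ≤ (β * (M - 1) * α) * ε := by gcongr
          _ = β * ((M - 1) * (α * ε)) := by ring
          _ ≤ _ := by
            gcongr
            rwa [le_div_iff₀ hT]
      calc wnorm P (z₁ s) ≤ wnorm P (y s) + (1 - α) * ε := hz₁w s hs'
        _ ≤ ((t + T - s) * M + s - t) / T * (α * ε) + h / T * ((M - 1) * (α * ε)) :=
          add_le_add h1 h2
        _ = _ := by ring
    · have hs' : s ∈ Icc (t + T) (t + h + T) := ⟨hsT, hs.2⟩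
      have := e2 hs'
      simp only at this
      rw [this]
      have hQl := lamMin_pos hn (posDef_qStar hQ hR K)
      have hPl := lamMax_pos hn hP
      have h1 := exp_neg_le_of_exp_neg_le (τ := s - (t + T)) (h := h) (by positivity)
        (mul_pos hβ hT) hα1.le hTα (by linarith) (by linarith [hs.2]) hh
      -- The new constraint equals `αε(1 + (h - τ)(M - 1)/T)` with `τ = s - (t + T)`; the bound on
      -- `M` makes its slope dominate that of the chord.
      have h2 : (h - (s - (t + T))) / (β * T) * (1 - α)
          ≤ (h - (s - (t + T))) / T * ((M - 1) * α) := by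
        rw [div_mul_eq_mul_div, div_le_iff₀ (mul_pos hβ hT)]
        have h3 : 0 ≤ h - (s - (t + T)) := by linarith [hs.2]
        calc (h - (s - (t + T))) * (1 - α) ≤ (h - (s - (t + T))) * (β * (M - 1) * α) := by gcongr
          _ = _ := by field_simp
      calc wnorm P (z₂ s) ≤ ε * Real.exp _ := (hz₂w s hs').2
        _ ≤ ε * (α + (h - (s - (t + T))) / T * ((M - 1) * α)) := by
          gcongr
          linarith
        _ = _ := by field_simp; ring

/-! ### The triggering instants -/

lemma norm_sub_le_of_disturbance {n m : ℕ} {f : Vec n → Vec m → Vec n} {U : Set (Vec m)} {L ρ : ℝ}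
    (hL : 0 < L) (hLip : ∀ u ∈ U, ∀ x y : Vec n, ‖f x u - f y u‖ ≤ L * ‖x - y‖)
    {w x y : ℝ → Vec n} {u : ℝ → Vec m} {a b : ℝ} (hw : ∀ s, ‖w s‖ ≤ ρ)
    (hu : ∀ s ∈ Icc a b, u s ∈ U) (hx : IsSolution (fun s z => f z (u s) + w s) a b x)
    (hy : IsSolution (fun s z => f z (u s)) a b y) (hxy : x a = y a) :
    ∀ s ∈ Icc a b, ‖x s - y s‖ ≤ ρ / L * (Real.exp (L * (s - a)) - 1) := by
  intro s hs
  have h := hx.norm_sub_le (r := ρ) hL.le hy (fun τ hτ => by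
    rw [add_sub_right_comm]
    exact (norm_add_le _ _).trans (add_le_add (hLip _ (hu τ hτ) _ _) (hw τ))) s hs
  rw [hxy, sub_self, norm_zero, gronwallBound_of_K_ne_0 hL.ne'] at h
  simpa using h

/-- The bracket in `δ` is the primitive of `s e^{Ls}` vanishing at 0, evaluated at `βT`. -/
lemma hasDerivAt_triggerProfile {L : ℝ} (hL : L ≠ 0) (s : ℝ) :
    HasDerivAt (fun s => Real.exp (L * s) * (s / L - 1 / L ^ 2) + 1 / L ^ 2)
      (s * Real.exp (L * s)) s := by
  have h1 : HasDerivAt (fun s => Real.exp (L * s)) (Real.exp (L * s) * (L * 1)) s :=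
    ((hasDerivAt_id s).const_mul L).exp
  have h2 : HasDerivAt (fun s => s / L - 1 / L ^ 2) (1 / L) s :=
    ((hasDerivAt_id s).div_const L).sub_const _
  refine ((h1.mul h2).add_const (1 / L ^ 2)).congr_deriv ?_
  field_simp
  ring

lemma triggerProfile_lt {L a b : ℝ} (hL : 0 < L) (ha : 0 ≤ a) (hab : a < b) :
    Real.exp (L * a) * (a / L - 1 / L ^ 2) + 1 / L ^ 2
      < Real.exp (L * b) * (b / L - 1 / L ^ 2) + 1 / L ^ 2 := by
  refine strictMonoOn_of_deriv_pos (convex_Ici 0)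
    (fun s _ => (hasDerivAt_triggerProfile hL.ne' s).continuousAt.continuousWithinAt)
    (fun s hs => ?_) ha (ha.trans hab.le) hab
  rw [interior_Ici, mem_Ioi] at hs
  rw [(hasDerivAt_triggerProfile hL.ne' s).deriv]
  positivity

lemma triggerFactor_pos {n : ℕ} (hn : 0 < n) {P : Matrix (Fin n) (Fin n) ℝ} (hP : P.PosDef)
    {L β T : ℝ} (hL : 0 < L) (hβT : 0 < β * T) : 0 < triggerFactor P L β T := by
  refine mul_pos (lamMax_pos hn (posDef_sqrt hP)) ?_
  have := triggerProfile_lt hL le_rfl hβT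
  simpa [mul_assoc] using this

/-- This is `1 - Ls ≤ e^{-Ls}` multiplied by `e^{Ls}`. It replaces the Grönwall error bound by the
integrand behind `δ`. -/
lemma exp_sub_one_div_le {L s : ℝ} (hL : 0 < L) :
    (Real.exp (L * s) - 1) / L ≤ s * Real.exp (L * s) := by
  rw [div_le_iff₀ hL]
  have h1 := Real.add_one_le_exp (-(L * s))
  have h2 : Real.exp (-(L * s)) * Real.exp (L * s) = 1 := by
    rw [← Real.exp_add]; simp
  nlinarith [Real.exp_pos (L * s)]

/-- The accumulated prediction error stays below the triggering level for the time `βT`. -/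
lemma integral_wnorm_sub_lt {n : ℕ} (hn : 0 < n) {P : Matrix (Fin n) (Fin n) ℝ} (hP : P.PosDef)
    {L β T ρ : ℝ} (hL : 0 < L) (hρ : 0 < ρ) {x y : ℝ → Vec n} {t h : ℝ} (hh : 0 ≤ h)
    (hhβ : h < β * T) (hx : ContinuousOn x (Icc t (t + h))) (hy : ContinuousOn y (Icc t (t + h)))
    (hxy : ∀ s ∈ Icc t (t + h), ‖x s - y s‖ ≤ ρ / L * (Real.exp (L * (s - t)) - 1)) :
    ∫ s in t..(t + h), wnorm P (x s - y s) < triggerLevel P L β T ρ := by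
  have hl := lamMax_pos hn (posDef_sqrt hP)
  set l := lamMax (CFC.sqrt P) with hldef
  set Φ : ℝ → ℝ := fun s => Real.exp (L * s) * (s / L - 1 / L ^ 2) + 1 / L ^ 2 with hΦ
  have hder : ∀ s, HasDerivAt (fun s => ρ * l * Φ (s - t))
      (ρ * l * ((s - t) * Real.exp (L * (s - t)))) s := fun s =>
    ((hasDerivAt_triggerProfile hL.ne' (s - t)).comp_sub_const s t).const_mul (ρ * l)
  have hth : t ≤ t + h := by linarith
  have hcont : Continuous fun s => ρ * l * ((s - t) * Real.exp (L * (s - t))) := by fun_prop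
  calc ∫ s in t..(t + h), wnorm P (x s - y s)
      ≤ ∫ s in t..(t + h), ρ * l * ((s - t) * Real.exp (L * (s - t))) := by
        refine intervalIntegral.integral_mono_on hth ?_ (hcont.intervalIntegrable _ _) ?_
        · refine ContinuousOn.intervalIntegrable ?_
          rw [uIcc_of_le hth]
          exact (continuous_wnorm P).comp_continuousOn (hx.sub hy)
        · intro s hs
          calc wnorm P (x s - y s) ≤ l * (ρ / L * (Real.exp (L * (s - t)) - 1)) :=
                (wnorm_le hP _).trans (by gcongr; exact hxy s hs)
            _ = ρ * l * ((Real.exp (L * (s - t)) - 1) / L) := by ring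
            _ ≤ _ := by
              gcongr
              exact exp_sub_one_div_le hL
    _ = ρ * l * Φ h := by
        rw [intervalIntegral.integral_eq_sub_of_hasDerivAt (fun s _ => hder s)
          (hcont.intervalIntegrable _ _)]
        simp [hΦ]
    _ < ρ * l * Φ (β * T) := by
        gcongr
        exact triggerProfile_lt hL hh hhβ
    _ = _ := by
        rw [triggerLevel, triggerFactor, ← hldef, hΦ]
        ring_nf

/-! ### Recursive feasibility of the closed loop -/

lemma norm_le_disturbanceBound {n : ℕ} {W : Set (Vec n)} (hW : IsCompact W) {w : Vec n}
    (hw : w ∈ W) : ‖w‖ ≤ disturbanceBound W :=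
  le_csSup (hW.image continuous_norm).bddAbove (mem_image_of_mem _ hw)

/-- The error propagated over the whole horizon is at most the amplified triggering level. -/
lemma lamMax_mul_exp_le_errorGain_mul {n : ℕ} (hn : 0 < n) {P : Matrix (Fin n) (Fin n) ℝ}
    (hP : P.PosDef) {L β T ρ : ℝ} (hL : 0 < L) (ha : 1 < L * β * T) (hρ : 0 ≤ ρ) :
    lamMax (CFC.sqrt P) * (ρ / L * Real.exp (L * T))
      ≤ errorGain L β T * triggerLevel P L β T ρ := by
  have hl := lamMax_pos hn (posDef_sqrt hP)
  have hexp : Real.exp (L * (1 - β) * T) * Real.exp (L * β * T) = Real.exp (L * T) := by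
    rw [← Real.exp_add]; congr 1; ring
  have ha' : 0 < L * β * T - 1 := by linarith
  -- The denominator `LβT - 1` of `G` cancels the same factor in the leading term of `δ`. What
  -- remains exceeds the target by the factor `LβT > 1` and a nonnegative term.
  have e : errorGain L β T * triggerLevel P L β T ρ
      = lamMax (CFC.sqrt P) * (ρ / L * (L * β * T * (Real.exp (L * T)
        + Real.exp (L * (1 - β) * T) / (L * β * T - 1)))) := by
    rw [errorGain, triggerLevel, triggerFactor, ← hexp]
    field_simp
  rw [e]
  gcongr
  have h1 : 0 ≤ Real.exp (L * (1 - β) * T) / (L * β * T - 1) := by positivity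
  nlinarith [Real.exp_pos (L * T)]

theorem iterativelyFeasible_of_le {n m : ℕ} (hn : 0 < n) {f : Vec n → Vec m → Vec n}
    (hf : ContDiff ℝ 2 (fun z : Vec n × Vec m => f z.1 z.2)) {U : Set (Vec m)} (hU : IsCompact U)
    {L : ℝ} (hL : 0 < L) (hLip : ∀ u ∈ U, ∀ x y : Vec n, ‖f x u - f y u‖ ≤ L * ‖x - y‖)
    {Q : Matrix (Fin n) (Fin n) ℝ} (hQ : Q.PosDef) {R : Matrix (Fin m) (Fin m) ℝ} (hR : R.PosDef)
    {K : Matrix (Fin m) (Fin n) ℝ} {κ : ℝ} {P : Matrix (Fin n) (Fin n) ℝ} {ε : ℝ}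
    (hd : IsTerminalDesign f U Q R K κ P ε) {α β T M ρ : ℝ} (hα : 0 < α) (hα1 : α < 1)
    (hβ : 0 < β) (hβ1 : β < 1) (ha : 1 < L * β * T) (hρ : 0 ≤ ρ)
    (hδ : errorGain L β T * triggerLevel P L β T ρ ≤ (1 - α) * ε)
    (hM : 1 - α ≤ β * (M - 1) * α)
    (hTα : Real.exp (-(lamMin (qStar Q R K) / lamMax P / 2) * (β * T)) ≤ α)
    {w : ℝ → Vec n} (hw : ∀ s, ‖w s‖ ≤ ρ) {t₀ : ℝ} {x₀ : Vec n}
    (hfeas : ∃ v z, MPCProblem.IsFeasible ⟨f, U, Q, R, P, T, M, α, ε⟩ t₀ x₀ v z) :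
    IterativelyFeasible ⟨f, U, Q, R, P, T, M, α, ε⟩ (triggerLevel P L β T ρ) w t₀ x₀ := by
  intro N t ξ u y x hrun huy
  have hP := hd.posDef
  have hT : 0 < T := by
    by_contra h
    have : L * β * T ≤ 0 := mul_nonpos_of_nonneg_of_nonpos (by positivity) (not_lt.1 h)
    linarith
  have hβT : β * T ≤ T := by nlinarith
  -- No induction is needed: a feasible control was applied at the last instant, and it alone
  -- provides the candidate for the next one.
  rcases N with _ | k
  · rwa [hrun.time_zero, hrun.state_zero]
  have hk := huy k k.lt_succ_self
  have hx0 := hrun.real_init k k.lt_succ_self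
  have hxs := hrun.real_sol k k.lt_succ_self
  have hxy := norm_sub_le_of_disturbance hL hLip hw hk.input hxs hk.nominal
    (hx0.trans hk.init.symm)
  rw [hrun.state_succ k k.lt_succ_self]
  have htime := hrun.time_succ k k.lt_succ_self
  simp only at hxs htime hxy
  -- If `ρ = 0` then `δ = 0` and prediction equals reality, so every `h` in `(0, T]` triggers. The
  -- infimum is 0, time does not advance, and the old control remains feasible.
  rcases hρ.eq_or_lt with rfl | hρ0
  · have heq : ∀ s ∈ Icc (t k) (t k + T), x k s = y k s := fun s hs => by
      simpa [sub_eq_zero] using hxy s hs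
    have hset : insert T {h : ℝ | 0 < h ∧ h ≤ T ∧
        ∫ s in (t k)..(t k + h), wnorm P (x k s - y k s) = triggerLevel P L β T 0} = Ioc 0 T := by
      ext h
      simp only [mem_insert_iff, mem_ofPred_eq, mem_Ioc]
      constructor
      · rintro (rfl | h)
        · exact ⟨hT, le_rfl⟩
        · exact ⟨h.1, h.2.1⟩
      · rintro ⟨h0, h1⟩
        refine Or.inr ⟨h0, h1, ?_⟩
        rw [triggerLevel, zero_mul]
        refine intervalIntegral.integral_zero_ae (.of_forall fun s hs => ?_)
        rw [uIoc_of_le (by linarith)] at hs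
        rw [heq s ⟨hs.1.le, hs.2.trans (by linarith)⟩, sub_self, wnorm_zero]
    have ht : t (k + 1) = t k := by
      rw [htime, nextInstant, hset, csInf_Ioc hT, add_zero]
    rw [ht, hx0]
    exact ⟨_, _, hk⟩
  · set S := insert T {h : ℝ | 0 < h ∧ h ≤ T ∧
      ∫ s in (t k)..(t k + h), wnorm P (x k s - y k s) = triggerLevel P L β T ρ} with hS
    -- For `h < βT` the accumulated error is strictly below `δ`, so the inter-event time is at least
    -- `βT`.
    have hSβ : ∀ h ∈ S, β * T ≤ h := by
      rintro h (rfl | ⟨h0, h1, h2⟩)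
      · exact hβT
      · by_contra hlt
        have hsub : Icc (t k) (t k + h) ⊆ Icc (t k) (t k + T) :=
          Icc_subset_Icc le_rfl (by linarith)
        exact (integral_wnorm_sub_lt hn hP hL hρ0 h0.le (not_le.1 hlt) (hxs.1.mono hsub)
          (hk.nominal.1.mono hsub) fun s hs => hxy s (hsub hs)).ne h2
    have hTS : T ∈ S := mem_insert _ _
    have h1 : β * T ≤ sInf S := le_csInf ⟨T, hTS⟩ hSβ
    have h2 : sInf S ≤ T := csInf_le ⟨_, hSβ⟩ hTS
    have ht : t (k + 1) = t k + sInf S := htime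
    rw [ht]
    have h3 := hxy (t k + sInf S) ⟨by nlinarith, by linarith⟩
    rw [add_sub_cancel_left] at h3
    exact exists_isFeasible_shift hn hf hU hL hLip hQ hR hd hα hα1 hβ hT hρ
      ((lamMax_mul_exp_le_errorGain_mul hn hP hL ha hρ).trans hδ) hM hTα h1 h2 hk h3

theorem theorem2 {n m : ℕ} (hn : 0 < n)
    (f : Vec n → Vec m → Vec n)
    (hf : ContDiff ℝ 2 (fun z : Vec n × Vec m => f z.1 z.2))
    (hf0 : f 0 0 = 0)
    (U : Set (Vec m)) (hU : IsCompact U) (hU0 : (0 : Vec m) ∈ U)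
    (L : ℝ) (hL : 0 < L)
    (hLip : ∀ u ∈ U, ∀ x y : Vec n, ‖f x u - f y u‖ ≤ L * ‖x - y‖)
    (Q : Matrix (Fin n) (Fin n) ℝ) (hQ : Q.PosDef)
    (R : Matrix (Fin m) (Fin m) ℝ) (hR : R.PosDef)
    (hstab : ∃ K₀ : Matrix (Fin m) (Fin n) ℝ, IsHurwitz (jacA f + jacB f * K₀)) :
    (0 ∈ interior U →
      ∃ (K : Matrix (Fin m) (Fin n) ℝ) (κ : ℝ) (P : Matrix (Fin n) (Fin n) ℝ) (ε : ℝ),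
        IsTerminalDesign f U Q R K κ P ε) ∧
    ∀ (K : Matrix (Fin m) (Fin n) ℝ) (κ : ℝ) (P : Matrix (Fin n) (Fin n) ℝ) (ε : ℝ),
      IsTerminalDesign f U Q R K κ P ε →
    ∀ W : Set (Vec n), IsCompact W → W.Nonempty →
    ∀ α β T M : ℝ, 0 < α → α < 1 → 0 < β → β < 1 →
      L * β * T ≠ 1 →
      T ≥ max (-2 * (lamMax P / (lamMin (qStar Q R K) * β)) * Real.log α) (1 / (L * β)) →
      M ≥ max
        (errorGain L β T * (triggerLevel P L β T (disturbanceBound W) / (α * ε)) + 1)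
        (1 - 1 / β + 1 / (α * β)) →
      (errorGain L β T * triggerLevel P L β T (disturbanceBound W) ≤ (1 - α) * ε ↔
        disturbanceBound W ≤ (1 - α) * ε / (errorGain L β T * triggerFactor P L β T)) ∧
      (errorGain L β T * triggerLevel P L β T (disturbanceBound W) ≤ (1 - α) * ε →
        ∀ w : ℝ → Vec n, Measurable w → (∀ s, w s ∈ W) →
        ∀ (t₀ : ℝ) (x₀ : Vec n),
          (∃ v z, MPCProblem.IsFeasible ⟨f, U, Q, R, P, T, M, α, ε⟩ t₀ x₀ v z) →
          IterativelyFeasible ⟨f, U, Q, R, P, T, M, α, ε⟩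
            (triggerLevel P L β T (disturbanceBound W)) w t₀ x₀ ∧
          IterativelyFeasibleOptimal ⟨f, U, Q, R, P, T, M, α, ε⟩
            (triggerLevel P L β T (disturbanceBound W)) w t₀ x₀) := by
  obtain ⟨K₀, hK₀⟩ := hstab
  refine ⟨fun hU0' => ⟨K₀, exists_isTerminalDesign hn hf hf0 hU0' hQ hR hK₀⟩, ?_⟩
  intro K κ P ε hd W hW hWne α β T M hα hα1 hβ hβ1 hne hT hM
  have hP := hd.posDef
  have hε := hd.eps_pos
  have hQl := lamMin_pos hn (posDef_qStar hQ hR K)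
  have hPl := lamMax_pos hn hP
  -- Strictness makes the denominator of `G` positive, so that `(*)` can be solved for `ρ`.
  have ha : 1 < L * β * T := by
    have h1 : 1 / (L * β) ≤ T := (le_max_right _ _).trans hT
    rw [div_le_iff₀ (by positivity)] at h1
    exact lt_of_le_of_ne (by linarith) hne.symm
  have hβT : 0 < β * T := by
    by_contra h
    have : L * β * T ≤ 0 := by
      rw [mul_assoc]
      exact mul_nonpos_of_nonneg_of_nonpos hL.le (not_lt.1 h)
    linarith
  have hT0 : 0 < T := pos_of_mul_pos_right hβT hβ.le
  have hF := triggerFactor_pos hn hP hL hβT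
  have hG : 0 < errorGain L β T := by
    have : 0 < L * β * T - 1 := by linarith
    unfold errorGain
    positivity
  have hρ : 0 ≤ disturbanceBound W := by
    obtain ⟨w, hw⟩ := hWne
    exact (norm_nonneg w).trans (norm_le_disturbanceBound hW hw)
  constructor
  · rw [triggerLevel, le_div_iff₀ (mul_pos hG hF)]
    exact iff_of_eq (by congr 1; ring)
  intro hδ w _ hw t₀ x₀ hfeas
  -- The second lower bound on `M` is a rewriting of `M - 1 ≥ (1 - α)/(αβ)`.
  have hM' : 1 - α ≤ β * (M - 1) * α := by
    have h1 : 1 - 1 / β + 1 / (α * β) ≤ M := (le_max_right _ _).trans hM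
    have h2 : (1 - α) / (α * β) = 1 - 1 / β + 1 / (α * β) - 1 := by
      field_simp
      ring
    have h3 : (1 - α) / (α * β) ≤ M - 1 := by linarith
    rw [div_le_iff₀ (by positivity)] at h3
    linarith
  -- The logarithmic bound on `T` says that the terminal decay over the time `βT` reaches the factor
  -- `α`.
  have hTα : Real.exp (-(lamMin (qStar Q R K) / lamMax P / 2) * (β * T)) ≤ α := by
    rw [← Real.le_log_iff_exp_le hα]
    have h1 : -2 * (lamMax P / (lamMin (qStar Q R K) * β)) * Real.log α ≤ T :=
      (le_max_left _ _).trans hT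
    have h2 : -2 * (lamMax P / (lamMin (qStar Q R K) * β)) * Real.log α
        * (lamMin (qStar Q R K) / lamMax P / 2 * β) = -Real.log α := by
      field_simp
    have h3 := mul_le_mul_of_nonneg_right h1
      (show 0 ≤ lamMin (qStar Q R K) / lamMax P / 2 * β by positivity)
    rw [h2] at h3
    linarith
  have key := iterativelyFeasible_of_le hn hf hU hL hLip hQ hR hd hα hα1 hβ hβ1 ha hρ hδ hM' hTα
    (fun s => norm_le_disturbanceBound hW (hw s)) hfeas
  exact ⟨key, fun N t ξ u y x hrun hopt => key N t ξ u y x hrun fun k hk => (hopt k hk).1⟩
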